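/- Let $G$ and $H$ be (finite-dimensional, real) Lie groups with Lie algebras $\mathfrak g$, $\mathfrak h$, let $\iota\colon G\hookrightarrow H$ be the inclusion of a Lie subgroup (an injective immersive homomorphism), and let $\pi\colon P\to M$ be a smooth principal $G$-bundle with right action $r^g(u)=u\cdot g$ and fundamental vector fields $\zeta_X(u)=T_e(g\mapsto u\cdot g)X$, $X\in\mathfrak g$. Let $q\colon P\times H\to P[H]=P\times_G H$ be the quotient by $(u\cdot g,h)\sim(u,\iota(g)h)$; $P[H]$ is regarded as a principal $H$-bundle over $M$ with the action $q(u,h)\cdot k=q(u,hk)$ and with the smooth structure for which every local trivialization $u\mapsto(\pi(u),\gamma(u))$ of $P$ induces the local trivialization $q(u,h)\mapsto(\pi(u),\iota(\gamma(u))h)$. Write $\lambda_h$ for left translation by $h$ on $H$. A generalized Cartan connection is a smooth one-form $\kappa\in\Omega^1(P;\mathfrak h)$ with $\kappa\circ T(r^g)=\mathrm{Ad}(\iota(g)^{-1})\circ\kappa$ for all $g\in G$ and $\kappa(\zeta_X(u))=T_e\iota\,X$ for all $X\in\mathfrak g$, $u\in P$. A principal connection form on a principal $H$-bundle $Q$ is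 a smooth one-form $\omega\in\Omega^1(Q;\mathfrak h)$ with $\omega\circ T(r^k)=\mathrm{Ad}(k^{-1})\circ\omega$ for all $k\in H$ and $\omega(\zeta_Y)=Y$ for all $Y\in\mathfrak h$. Then there is a bijection $\kappa\mapsto q^\flat\kappa$ from the generalized Cartan connections on $P$ with values in $\mathfrak h$ onto the principal connection forms on $P[H]$ such that $$(q^\flat\kappa)\bigl(T_{(u,h)}q(X_u,T_e\lambda_h Y)\bigr)=Y+\mathrm{Ad}(h^{-1})\kappa_u(X_u)\qquad(u\in P,\ h\in H,\ X_u\in T_uP,\ Y\in\mathfrak h).$$ This formula determines the form $q^\flat\kappa$ uniquely among all families of linear maps $T_yP[H]\to\mathfrak h$ ($y\in P[H]$), and the inverse bijection is given by $$\bigl((q^\flat)^{-1}\omega\bigr)(X_u)=\omega\bigl(T_{(u,e)}q(X_u,0_e)\bigr).$$ -/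

import Mathlib

open scoped Manifold ContDiff Topology

noncomputable section

section PrincipalBundles

variable {EP KP EM KM EG KG EH KH : Type*}
  [NormedAddCommGroup EP] [NormedSpace ℝ EP] [TopologicalSpace KP]
  [NormedAddCommGroup EM] [NormedSpace ℝ EM] [TopologicalSpace KM]
  [NormedAddCommGroup EG] [NormedSpace ℝ EG] [TopologicalSpace KG]
  [NormedAddCommGroup EH] [NormedSpace ℝ EH] [TopologicalSpace KH]

/-- Smoothness on a model space, read in the model vector space. -/
theorem contDiffOn_of_contMDiffOn_model {I : ModelWithCorners ℝ EM KM} {f : KM → KM} {s : Set KM}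
    (h : ContMDiffOn I I ∞ f s) : ContDiffOn ℝ ∞ (I ∘ f ∘ I.symm) (I.symm ⁻¹' s ∩ Set.range I) := by
  intro z hz
  have := (contMDiffOn_iff.1 h).2 (I.symm z) (I.symm z)
  simp only [extChartAt, chartAt_self_eq, mfld_simps] at this
  rw [Set.inter_comm] at hz ⊢
  exact this z hz

/-- A local trivialization `π⁻¹(U) ≅ U × G` that is a diffeomorphism and intertwines the right
action `act` with right multiplication on the second factor. -/
structure IsPrincipalTrivialization
    (IP : ModelWithCorners ℝ EP KP) (IM : ModelWithCorners ℝ EM KM) (IG : ModelWithCorners ℝ EG KG)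
    {P M G : Type*}
    [TopologicalSpace P] [ChartedSpace KP P] [TopologicalSpace M] [ChartedSpace KM M]
    [TopologicalSpace G] [ChartedSpace KG G] [Group G]
    {proj : P → M} (act : P → G → P) (e : Bundle.Trivialization G proj) : Prop where
  contMDiffOn : ContMDiffOn IP (IM.prod IG) ∞ e e.source
  contMDiffOn_symm : ContMDiffOn (IM.prod IG) IP ∞ e.toOpenPartialHomeomorph.symm e.target
  equivariant : ∀ u ∈ e.source, ∀ g : G, (e (act u g)).2 = (e u).2 * g

/-- A smooth principal `G`-bundle with total space `P` and base `M`: a smooth right action of `G`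
on `P` preserving the fibres of `proj : P → M`, with smooth equivariant local trivializations
around every point of `M`. -/
structure PrincipalBundle
    (IP : ModelWithCorners ℝ EP KP) (IM : ModelWithCorners ℝ EM KM) (IG : ModelWithCorners ℝ EG KG)
    (P M G : Type*)
    [TopologicalSpace P] [ChartedSpace KP P] [TopologicalSpace M] [ChartedSpace KM M]
    [TopologicalSpace G] [ChartedSpace KG G] [Group G] where
  proj : P → M
  act : P → G → P
  contMDiff_proj : ContMDiff IP IM ∞ proj
  contMDiff_act : ContMDiff (IP.prod IG) IP ∞ fun p : P × G => act p.1 p.2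
  act_one : ∀ u, act u 1 = u
  act_mul : ∀ u g g', act u (g * g') = act (act u g) g'
  proj_act : ∀ u g, proj (act u g) = proj u
  exists_trivialization : ∀ x : M, ∃ e : Bundle.Trivialization G proj,
    x ∈ e.baseSet ∧ IsPrincipalTrivialization IP IM IG act e

/-- The homomorphism `ι : G → H` of Lie groups is the inclusion of a Lie subgroup: an injective
immersion. -/
structure IsLieSubgroup {IG : ModelWithCorners ℝ EG KG} {IH : ModelWithCorners ℝ EH KH}
    {G H : Type*} [TopologicalSpace G] [ChartedSpace KG G] [Group G]
    [TopologicalSpace H] [ChartedSpace KH H] [Group H]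
    (ι : ContMDiffMonoidMorphism IG IH ∞ G H) : Prop where
  injective : Function.Injective ι
  immersion : ∀ g : G, Function.Injective (mfderiv IG IH ι g)

/-- The adjoint representation: `Ad(h)` is the derivative at `1` of `k ↦ h k h⁻¹`. -/
def lieAd {H : Type*} [TopologicalSpace H] [ChartedSpace KH H] [Group H]
    (IH : ModelWithCorners ℝ EH KH) (h : H) :
    GroupLieAlgebra IH H →L[ℝ] GroupLieAlgebra IH H :=
  mfderiv IH IH (fun k : H => h * k * h⁻¹) 1

namespace PrincipalBundle

variable {IP : ModelWithCorners ℝ EP KP} {IM : ModelWithCorners ℝ EM KM}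
  {IG : ModelWithCorners ℝ EG KG} {IH : ModelWithCorners ℝ EH KH}
  {P M G H : Type*}
  [TopologicalSpace P] [ChartedSpace KP P]
  [TopologicalSpace M] [ChartedSpace KM M]
  [TopologicalSpace G] [ChartedSpace KG G] [Group G]
  [TopologicalSpace H] [ChartedSpace KH H] [Group H]

/-- The fundamental vector field `ζ_X(u) = T_e(r_u) X`. -/
def fundamental (B : PrincipalBundle IP IM IG P M G) (X : GroupLieAlgebra IG G) (u : P) :
    TangentSpace IP u :=
  mfderiv IG IP (fun g : G => B.act u g) 1 X

/-- A generalized principal Cartan connection on `P` with values in the Lie algebra of `H`, where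
`ι : G → H`: a smooth one-form `κ : TP → 𝔥` with `κ ∘ T(r^g) = Ad(g⁻¹) ∘ κ` and `κ(ζ_X) = X`. -/
structure GeneralizedCartanConnection [IsManifold IP ∞ P]
    (B : PrincipalBundle IP IM IG P M G) (ι : ContMDiffMonoidMorphism IG IH ∞ G H) where
  form : ∀ u : P, TangentSpace IP u →L[ℝ] GroupLieAlgebra IH H
  smooth : ContMDiff (M' := EH) IP.tangent 𝓘(ℝ, EH) ∞
    fun v : TangentBundle IP P => form v.1 v.2
  equivariant : ∀ (u : P) (g : G) (X : TangentSpace IP u),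
    form (B.act u g) (mfderiv IP IP (fun v : P => B.act v g) u X)
      = lieAd IH (ι g⁻¹) (form u X)
  reproduces : ∀ (u : P) (X : GroupLieAlgebra IG G),
    form u (B.fundamental X u) = mfderiv IG IH ι 1 X

/-- A principal connection form on a principal `G`-bundle: a smooth one-form `ω : TP → 𝔤` with
`ω ∘ T(r^g) = Ad(g⁻¹) ∘ ω` and `ω(ζ_X) = X`. -/
structure PrincipalConnection [IsManifold IP ∞ P] (B : PrincipalBundle IP IM IG P M G) where
  form : ∀ u : P, TangentSpace IP u →L[ℝ] GroupLieAlgebra IG G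
  smooth : ContMDiff (M' := EG) IP.tangent 𝓘(ℝ, EG) ∞
    fun v : TangentBundle IP P => form v.1 v.2
  equivariant : ∀ (u : P) (g : G) (X : TangentSpace IP u),
    form (B.act u g) (mfderiv IP IP (fun v : P => B.act v g) u X) = lieAd IG g⁻¹ (form u X)
  reproduces : ∀ (u : P) (X : GroupLieAlgebra IG G), form u (B.fundamental X u) = X

section Extension

variable (B : PrincipalBundle IP IM IG P M G) (ι : ContMDiffMonoidMorphism IG IH ∞ G H)

/-- The orbit relation of `G` on `P × H`, generated by `(u g, h) ∼ (u, g h)`. -/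
def extSetoid : Setoid (P × H) where
  r a b := ∃ g : G, b.1 = B.act a.1 g ∧ a.2 = ι g * b.2
  iseqv := by
    refine ⟨fun a => ⟨1, by simp [B.act_one]⟩, ?_, ?_⟩
    · rintro ⟨u, h⟩ ⟨u', h'⟩ ⟨g, h1, h2⟩
      refine ⟨g⁻¹, ?_, ?_⟩
      · simp only at h1
        simp only [h1, ← B.act_mul, mul_inv_cancel, B.act_one]
      · simp only at h2
        simp only [h2, map_inv, inv_mul_cancel_left]
    · rintro ⟨u, h⟩ ⟨u', h'⟩ ⟨u'', h''⟩ ⟨g, h1, h2⟩ ⟨g', h3, h4⟩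
      refine ⟨g * g', ?_, ?_⟩
      · simp only at h1 h3
        simp only [h3, h1, B.act_mul]
      · simp only at h2 h4
        simp only [h2, h4, map_mul, mul_assoc]

/-- The total space `P[H] = P ×_G H` of the extension of the structure group. -/
def Ext : Type _ := Quotient (B.extSetoid ι)

instance : TopologicalSpace (B.Ext ι) := inferInstanceAs (TopologicalSpace (Quotient _))

/-- The projection `q : P × H → P[H]`. -/
def extMk (p : P × H) : B.Ext ι := Quotient.mk (B.extSetoid ι) p

theorem extMk_act (u : P) (g : G) (h : H) :
    B.extMk ι (B.act u g, h) = B.extMk ι (u, ι g * h) :=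
  (Quotient.sound (s := B.extSetoid ι) ⟨g, rfl, rfl⟩).symm

theorem isQuotientMap_extMk : Topology.IsQuotientMap (B.extMk ι) := isQuotientMap_quotient_mk'

theorem extMk_surjective : Function.Surjective (B.extMk ι) := Quotient.mk_surjective

/-- The map on `P[H]` induced by a `G`-invariant map on `P × H`. -/
def extLift {α : Type*} (f : P × H → α)
    (hf : ∀ (u : P) (g : G) (h : H), f (B.act u g, h) = f (u, ι g * h)) : B.Ext ι → α :=
  Quotient.lift f (by
    rintro ⟨u, h⟩ ⟨u', h'⟩ ⟨g, h1, h2⟩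
    have h1' : u' = B.act u g := h1
    have h2' : h = ι g * h' := h2
    rw [h1', h2', hf])

@[simp] theorem extLift_mk {α : Type*} (f : P × H → α)
    (hf : ∀ (u : P) (g : G) (h : H), f (B.act u g, h) = f (u, ι g * h)) (p : P × H) :
    B.extLift ι f hf (B.extMk ι p) = f p := rfl

/-- The bundle projection `P[H] → M`, `q(u, h) ↦ π(u)`. -/
def extProj : B.Ext ι → M :=
  B.extLift ι (fun p => B.proj p.1) fun u g _ => B.proj_act u g

@[simp] theorem extProj_mk (u : P) (h : H) : B.extProj ι (B.extMk ι (u, h)) = B.proj u := rfl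

theorem continuous_extProj : Continuous (B.extProj ι) :=
  (B.isQuotientMap_extMk ι).continuous_iff.2 (B.contMDiff_proj.continuous.comp continuous_fst)

/-- The right action of `H` on `P[H]`: `q(u, h) h' = q(u, h h')`. -/
def extAct (x : B.Ext ι) (k : H) : B.Ext ι :=
  B.extLift ι (fun p => B.extMk ι (p.1, p.2 * k))
    (fun u g h => by simp only [B.extMk_act, mul_assoc]) x

@[simp] theorem extAct_mk (u : P) (h k : H) :
    B.extAct ι (B.extMk ι (u, h)) k = B.extMk ι (u, h * k) := rfl

theorem extProj_act (x : B.Ext ι) (k : H) : B.extProj ι (B.extAct ι x k) = B.extProj ι x := by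
  obtain ⟨⟨u, h⟩, rfl⟩ := B.extMk_surjective ι x
  rfl

variable {B} {e : Bundle.Trivialization G B.proj}

theorem trivialization_inv_act (he : IsPrincipalTrivialization IP IM IG B.act e) {u : P}
    (hu : B.proj u ∈ e.baseSet) :
    B.act (e.toOpenPartialHomeomorph.symm (B.proj u, 1)) (e u).2 = u := by
  have h1 : (B.proj u, (1 : G)) ∈ e.target := by simp [e.target_eq, hu]
  have h2 := e.map_target h1
  have h3 := e.proj_symm_apply h1
  have h4 := e.apply_symm_apply h1
  have h5 : e (B.act (e.toOpenPartialHomeomorph.symm (B.proj u, 1)) (e u).2) = e u := by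
    apply Prod.ext
    · rw [e.coe_fst' (by rw [B.proj_act, h3]; exact hu), e.coe_fst' hu, B.proj_act, h3]
    · rw [he.equivariant _ h2, h4, one_mul]
  refine e.injOn ?_ ?_ h5
  · rw [e.mem_source, B.proj_act]; exact (e.mem_source).1 h2
  · exact (e.mem_source).2 hu

variable [LieGroup IH ∞ H]

open Classical in
/-- The trivialization `q(u, h) ↦ (π(u), γ(u) h)` of `P[H]` over `U` that is induced by a
trivialization `u ↦ (π(u), γ(u))` of `P` over `U` (with a junk value away from `U`). -/
def extTrivialization (ι : ContMDiffMonoidMorphism IG IH ∞ G H)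
    (he : IsPrincipalTrivialization IP IM IG B.act e) :
    Bundle.Trivialization H (B.extProj ι) where
  toFun := B.extLift ι
    (fun p => (B.proj p.1, if B.proj p.1 ∈ e.baseSet then ι (e p.1).2 * p.2 else 1)) (by
      intro u g h
      simp only [B.proj_act]
      split_ifs with hu
      · rw [he.equivariant u (e.mem_source.2 hu), map_mul, mul_assoc]
      · rfl)
  invFun y := B.extMk ι (e.toOpenPartialHomeomorph.symm (y.1, 1), y.2)
  source := B.extProj ι ⁻¹' e.baseSet
  target := e.baseSet ×ˢ Set.univ
  map_source' := by
    intro x hx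
    obtain ⟨⟨u, h⟩, rfl⟩ := B.extMk_surjective ι x
    exact ⟨hx, trivial⟩
  map_target' := by
    rintro ⟨x, h⟩ ⟨hx, -⟩
    have h1 : (x, (1 : G)) ∈ e.target := by rw [e.target_eq]; exact ⟨hx, trivial⟩
    simp only [Set.mem_preimage, extProj_mk]
    rw [e.proj_symm_apply h1]; exact hx
  left_inv' := by
    intro x hx
    obtain ⟨⟨u, h⟩, rfl⟩ := B.extMk_surjective ι x
    have hu : B.proj u ∈ e.baseSet := hx
    change B.extMk ι (e.toOpenPartialHomeomorph.symm (B.proj u, 1),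
      if B.proj u ∈ e.baseSet then ι (e u).2 * h else 1) = _
    rw [if_pos hu, ← B.extMk_act, trivialization_inv_act he hu]
  right_inv' := by
    rintro ⟨x, h⟩ ⟨hx, -⟩
    have h1 : (x, (1 : G)) ∈ e.target := by rw [e.target_eq]; exact ⟨hx, trivial⟩
    have h3 := e.proj_symm_apply h1
    have h4 := e.apply_symm_apply h1
    change (B.proj (e.toOpenPartialHomeomorph.symm (x, 1)),
      if B.proj (e.toOpenPartialHomeomorph.symm (x, 1)) ∈ e.baseSet then
        ι (e (e.toOpenPartialHomeomorph.symm (x, 1))).2 * h else 1) = _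
    rw [h3, if_pos hx, h4, map_one, one_mul]
  open_source := e.open_baseSet.preimage (B.continuous_extProj ι)
  open_target := e.open_baseSet.prod isOpen_univ
  continuousOn_toFun := by
    have := topologicalGroup_of_lieGroup IH ∞ (G := H)
    have hι : Continuous ι := ι.contMDiff_toFun.continuous
    refine ((B.isQuotientMap_extMk ι).continuousOn_isOpen_iff
      (e.open_baseSet.preimage (B.continuous_extProj ι))).2 ?_
    have hmaps : Set.MapsTo (Prod.fst : P × H → P)
        (B.extMk ι ⁻¹' (B.extProj ι ⁻¹' e.baseSet)) e.source := by
      rintro ⟨u, h⟩ hu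
      exact e.mem_source.2 hu
    have h1 : ContinuousOn (fun p : P × H => (B.proj p.1, ι (e p.1).2 * p.2))
        (B.extMk ι ⁻¹' (B.extProj ι ⁻¹' e.baseSet)) := by
      refine (B.contMDiff_proj.continuous.comp continuous_fst).continuousOn.prodMk ?_
      refine ContinuousOn.mul ?_ continuous_snd.continuousOn
      exact hι.comp_continuousOn (continuous_snd.comp_continuousOn
        (e.continuousOn_toFun.comp continuous_fst.continuousOn hmaps))
    refine h1.congr ?_
    rintro ⟨u, h⟩ hu
    have hu' : B.proj u ∈ e.baseSet := hu
    change (B.proj u, if B.proj u ∈ e.baseSet then ι (e u).2 * h else 1) = _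
    rw [if_pos hu']
  continuousOn_invFun := by
    refine (B.isQuotientMap_extMk ι).continuous.comp_continuousOn ?_
    refine ContinuousOn.prodMk ?_ continuous_snd.continuousOn
    refine e.toOpenPartialHomeomorph.continuousOn_symm.comp
      (continuous_fst.prodMk continuous_const).continuousOn ?_
    rintro ⟨x, h⟩ ⟨hx, -⟩
    rw [e.target_eq]; exact ⟨hx, trivial⟩
  baseSet := e.baseSet
  open_baseSet := e.open_baseSet
  source_eq := rfl
  target_eq := rfl
  proj_toFun := by
    intro x hx
    obtain ⟨⟨u, h⟩, rfl⟩ := B.extMk_surjective ι x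
    rfl

theorem extTrivialization_mk (he : IsPrincipalTrivialization IP IM IG B.act e) {u : P}
    (hu : B.proj u ∈ e.baseSet) (h : H) :
    extTrivialization ι he (B.extMk ι (u, h)) = (B.proj u, ι (e u).2 * h) := by
  classical
  change (B.proj u, if B.proj u ∈ e.baseSet then ι (e u).2 * h else 1) = _
  rw [if_pos hu]

theorem extTrivialization_symm (he : IsPrincipalTrivialization IP IM IG B.act e) (y : M × H) :
    (extTrivialization ι he).toOpenPartialHomeomorph.symm y =
      B.extMk ι (e.toOpenPartialHomeomorph.symm (y.1, 1), y.2) := rfl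

/-- The charts of `P[H]`: a trivialization of `P[H]` induced by one of `P`, followed by charts of
`M` and `H`. -/
def extChart (ι : ContMDiffMonoidMorphism IG IH ∞ G H)
    (he : IsPrincipalTrivialization IP IM IG B.act e)
    (φ : OpenPartialHomeomorph M KM) (ψ : OpenPartialHomeomorph H KH) :
    OpenPartialHomeomorph (B.Ext ι) (ModelProd KM KH) :=
  (extTrivialization ι he).toOpenPartialHomeomorph ≫ₕ φ.prod ψ

variable (B)

instance : ChartedSpace (ModelProd KM KH) (B.Ext ι) where
  atlas := {c | ∃ (e : Bundle.Trivialization G B.proj)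
    (he : IsPrincipalTrivialization IP IM IG B.act e),
    ∃ φ ∈ atlas KM M, ∃ ψ ∈ atlas KH H, c = extChart ι he φ ψ}
  chartAt x := extChart ι (B.exists_trivialization (B.extProj ι x)).choose_spec.2
    (chartAt KM (B.extProj ι x))
    (chartAt KH (extTrivialization ι
      (B.exists_trivialization (B.extProj ι x)).choose_spec.2 x).2)
  mem_chart_source x := by
    have h1 := (B.exists_trivialization (B.extProj ι x)).choose_spec.1
    have he := (B.exists_trivialization (B.extProj ι x)).choose_spec.2
    have h2 : x ∈ (extTrivialization ι he).source := h1
    have h3 : (extTrivialization ι he x).1 = B.extProj ι x :=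
      (extTrivialization ι he).coe_fst h2
    refine ⟨h2, ?_, ?_⟩
    · change (extTrivialization ι he x).1 ∈ _
      rw [h3]; exact mem_chart_source _ _
    · exact mem_chart_source KH (extTrivialization ι he x).2
  chart_mem_atlas x := ⟨_, _, _, chart_mem_atlas _ _, _, chart_mem_atlas _ _, rfl⟩

variable {B}

theorem contMDiffOn_extTransition {e e' : Bundle.Trivialization G B.proj}
    (he : IsPrincipalTrivialization IP IM IG B.act e)
    (he' : IsPrincipalTrivialization IP IM IG B.act e') :
    ContMDiffOn (IM.prod IH) (IM.prod IH) ∞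
      (extTrivialization ι he' ∘ (extTrivialization ι he).toOpenPartialHomeomorph.symm)
      ((e.baseSet ∩ e'.baseSet) ×ˢ Set.univ) := by
  have hs : ContMDiffOn (IM.prod IH) IP ∞
      (fun y : M × H => e.toOpenPartialHomeomorph.symm (y.1, 1))
      ((e.baseSet ∩ e'.baseSet) ×ˢ Set.univ) := by
    refine he.contMDiffOn_symm.comp (contMDiff_fst.prodMk contMDiff_const).contMDiffOn ?_
    rintro ⟨x, h⟩ ⟨hx, -⟩
    rw [e.target_eq]; exact ⟨hx.1, trivial⟩
  have hp : ∀ y ∈ ((e.baseSet ∩ e'.baseSet) ×ˢ Set.univ : Set (M × H)),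
      B.proj (e.toOpenPartialHomeomorph.symm (y.1, 1)) = y.1 := by
    rintro ⟨x, h⟩ ⟨hx, -⟩
    exact e.proj_symm_apply (x := (x, 1)) (by rw [e.target_eq]; exact ⟨hx.1, trivial⟩)
  have h1 : ContMDiffOn (IM.prod IH) (IM.prod IH) ∞
      (fun y : M × H => (y.1, ι (e' (e.toOpenPartialHomeomorph.symm (y.1, 1))).2 * y.2))
      ((e.baseSet ∩ e'.baseSet) ×ˢ Set.univ) := by
    refine contMDiffOn_fst.prodMk (ContMDiffOn.mul ?_ contMDiffOn_snd)
    refine ι.contMDiff_toFun.comp_contMDiffOn (contMDiff_snd.comp_contMDiffOn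
      (he'.contMDiffOn.comp hs ?_))
    intro y hy
    rw [Set.mem_preimage, e'.mem_source, hp y hy]
    exact hy.1.2
  refine h1.congr ?_
  intro y hy
  rw [Function.comp_apply, extTrivialization_symm,
    extTrivialization_mk ι he' (by rw [hp y hy]; exact hy.1.2), hp y hy]

variable (B)

instance [IsManifold IM ∞ M] : IsManifold (IM.prod IH) ∞ (B.Ext ι) := by
  apply isManifold_of_contDiffOn
  rintro c c' ⟨e, he, φ, hφ, ψ, hψ, rfl⟩ ⟨e', he', φ', hφ', ψ', hψ', rfl⟩
  have hφ1 := IsManifold.subset_maximalAtlas (I := IM) (n := ∞) hφ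
  have hφ2 := IsManifold.subset_maximalAtlas (I := IM) (n := ∞) hφ'
  have hψ1 := IsManifold.subset_maximalAtlas (I := IH) (n := ∞) hψ
  have hψ2 := IsManifold.subset_maximalAtlas (I := IH) (n := ∞) hψ'
  refine contDiffOn_of_contMDiffOn_model ?_
  have h1 := contMDiffOn_symm_of_mem_maximalAtlas
    (IsManifold.mem_maximalAtlas_prod hφ1 hψ1)
  have h2 := contMDiffOn_of_mem_maximalAtlas
    (IsManifold.mem_maximalAtlas_prod hφ2 hψ2)
  have h3 := (contMDiffOn_extTransition ι he he').comp (h1.mono (t :=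
    ((extChart ι he φ ψ).symm ≫ₕ extChart ι he' φ' ψ').source) ?_) ?_
  · refine (h2.comp h3 ?_)
    intro z hz
    exact hz.2.2
  · intro z hz
    exact hz.1.1
  · intro z hz
    refine ⟨⟨hz.1.2.1, ?_⟩, trivial⟩
    have h4 := hz.2.1
    have h5 := (extTrivialization ι he).proj_symm_apply hz.1.2
    change B.extProj ι ((extTrivialization ι he).toOpenPartialHomeomorph.symm
      ((φ.prod ψ).symm z)) ∈ e'.baseSet at h4
    rw [h5] at h4
    exact h4

variable {B}

theorem contMDiffOn_extTrivialization [IsManifold IM ∞ M]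
    (he : IsPrincipalTrivialization IP IM IG B.act e) :
    ContMDiffOn (IM.prod IH) (IM.prod IH) ∞ (extTrivialization ι he)
      (extTrivialization ι he).source := by
  intro x hx
  set y := extTrivialization ι he x with hy
  have hφ := IsManifold.chart_mem_maximalAtlas (I := IM) (n := ∞) y.1
  have hψ := IsManifold.chart_mem_maximalAtlas (I := IH) (n := ∞) y.2
  have h1 := contMDiffOn_symm_of_mem_maximalAtlas (IsManifold.mem_maximalAtlas_prod hφ hψ)
  have hc : extChart ι he (chartAt KM y.1) (chartAt KH y.2) ∈
      IsManifold.maximalAtlas (IM.prod IH) ∞ (B.Ext ι) :=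
    IsManifold.subset_maximalAtlas
      ⟨e, he, _, chart_mem_atlas _ _, _, chart_mem_atlas _ _, rfl⟩
  have h2 := contMDiffOn_of_mem_maximalAtlas hc
  have hxs : x ∈ (extChart ι he (chartAt KM y.1) (chartAt KH y.2)).source :=
    ⟨hx, mem_chart_source KM y.1, mem_chart_source KH y.2⟩
  have h3 := h1.comp h2 (fun z hz =>
    ((chartAt KM y.1).prod (chartAt KH y.2)).map_source hz.2)
  have h4 := h3.contMDiffAt ((extChart ι he (chartAt KM y.1)
    (chartAt KH y.2)).open_source.mem_nhds hxs)
  refine (h4.congr_of_eventuallyEq ?_).contMDiffWithinAt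
  filter_upwards [(extChart ι he (chartAt KM y.1) (chartAt KH y.2)).open_source.mem_nhds hxs]
    with z hz
  exact (((chartAt KM y.1).prod (chartAt KH y.2)).left_inv hz.2).symm

theorem contMDiffOn_extTrivialization_symm [IsManifold IM ∞ M]
    (he : IsPrincipalTrivialization IP IM IG B.act e) :
    ContMDiffOn (IM.prod IH) (IM.prod IH) ∞
      (extTrivialization ι he).toOpenPartialHomeomorph.symm (extTrivialization ι he).target := by
  intro y hyt
  have hφ := IsManifold.chart_mem_maximalAtlas (I := IM) (n := ∞) y.1
  have hψ := IsManifold.chart_mem_maximalAtlas (I := IH) (n := ∞) y.2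
  have h1 := contMDiffOn_of_mem_maximalAtlas (IsManifold.mem_maximalAtlas_prod hφ hψ)
  have hc : extChart ι he (chartAt KM y.1) (chartAt KH y.2) ∈
      IsManifold.maximalAtlas (IM.prod IH) ∞ (B.Ext ι) :=
    IsManifold.subset_maximalAtlas
      ⟨e, he, _, chart_mem_atlas _ _, _, chart_mem_atlas _ _, rfl⟩
  have h2 := contMDiffOn_symm_of_mem_maximalAtlas hc
  have hys : y ∈ ((chartAt KM y.1).prod (chartAt KH y.2)).source :=
    ⟨mem_chart_source KM y.1, mem_chart_source KH y.2⟩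
  have ho : ((chartAt KM y.1).prod (chartAt KH y.2)).source ∩
      (extTrivialization ι he).target ∈ 𝓝 y :=
    Filter.inter_mem (((chartAt KM y.1).prod (chartAt KH y.2)).open_source.mem_nhds hys)
      ((extTrivialization ι he).open_target.mem_nhds hyt)
  have h3 := h2.comp (h1.mono Set.inter_subset_left) (s :=
      ((chartAt KM y.1).prod (chartAt KH y.2)).source ∩ (extTrivialization ι he).target) (by
    rintro z ⟨hz, hz'⟩
    refine ⟨OpenPartialHomeomorph.map_source _ hz, ?_⟩
    change ((chartAt KM y.1).prod (chartAt KH y.2)).symm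
      (((chartAt KM y.1).prod (chartAt KH y.2)) z) ∈ (extTrivialization ι he).target
    rw [OpenPartialHomeomorph.left_inv _ hz]; exact hz')
  have h4 := h3.contMDiffAt ho
  refine (h4.congr_of_eventuallyEq ?_).contMDiffWithinAt
  filter_upwards [ho] with z hz
  change _ = (extTrivialization ι he).toOpenPartialHomeomorph.symm
    (((chartAt KM y.1).prod (chartAt KH y.2)).symm
      (((chartAt KM y.1).prod (chartAt KH y.2)) z))
  rw [OpenPartialHomeomorph.left_inv _ hz.1]

theorem extTrivialization_act (he : IsPrincipalTrivialization IP IM IG B.act e)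
    {x : B.Ext ι} (hx : x ∈ (extTrivialization ι he).source) (k : H) :
    extTrivialization ι he (B.extAct ι x k) =
      ((extTrivialization ι he x).1, (extTrivialization ι he x).2 * k) := by
  obtain ⟨⟨u, h⟩, rfl⟩ := B.extMk_surjective ι x
  have hu : B.proj u ∈ e.baseSet := hx
  rw [extAct_mk, extTrivialization_mk ι he hu, extTrivialization_mk ι he hu, mul_assoc]

variable (B)

/-- The extension of the structure group: `P[H] = P ×_G H` as a principal `H`-bundle over `M`. -/
def extend [IsManifold IM ∞ M] : PrincipalBundle (IM.prod IH) IM IH (B.Ext ι) M H where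
  proj := B.extProj ι
  act := B.extAct ι
  contMDiff_proj := by
    intro x
    obtain ⟨e, hx, he⟩ := B.exists_trivialization (B.extProj ι x)
    have hs : (extTrivialization ι he).source ∈ 𝓝 x :=
      (extTrivialization ι he).open_source.mem_nhds hx
    have h := contMDiff_fst.contMDiffAt.comp x
      ((contMDiffOn_extTrivialization ι he).contMDiffAt hs)
    refine h.congr_of_eventuallyEq ?_
    filter_upwards [hs] with z hz
    exact ((extTrivialization ι he).coe_fst hz).symm
  contMDiff_act := by
    rintro ⟨x, k⟩
    obtain ⟨e, hx, he⟩ := B.exists_trivialization (B.extProj ι x)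
    have hs : Prod.fst ⁻¹' (extTrivialization ι he).source ∈ 𝓝 (x, k) :=
      ((extTrivialization ι he).open_source.preimage continuous_fst).mem_nhds hx
    have h1 := (contMDiffOn_extTrivialization ι he).comp
      (contMDiffOn_fst (I := IM.prod IH) (J := IH) (N := H)
        (s := Prod.fst ⁻¹' (extTrivialization ι he).source)) (fun z hz => hz)
    have h2 := (contMDiff_fst.comp_contMDiffOn h1).prodMk
      ((contMDiff_snd.comp_contMDiffOn h1).mul contMDiffOn_snd)
    have h3 := (contMDiffOn_extTrivialization_symm ι he).comp h2 (by
      rintro ⟨z, k'⟩ hz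
      exact ⟨((extTrivialization ι he).map_source hz).1, trivial⟩)
    refine (h3.contMDiffAt hs).congr_of_eventuallyEq ?_
    filter_upwards [hs] with z hz
    have h4 := extTrivialization_act ι he hz z.2
    have h5 : B.extAct ι z.1 z.2 ∈ (extTrivialization ι he).source := by
      rw [Bundle.Trivialization.mem_source, extProj_act]; exact hz
    have h6 := (extTrivialization ι he).toOpenPartialHomeomorph.left_inv h5
    exact h6.symm.trans (congrArg _ h4)
  act_one x := by
    obtain ⟨⟨u, h⟩, rfl⟩ := B.extMk_surjective ι x
    simp
  act_mul x k k' := by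
    obtain ⟨⟨u, h⟩, rfl⟩ := B.extMk_surjective ι x
    simp [mul_assoc]
  proj_act := B.extProj_act ι
  exists_trivialization x := by
    obtain ⟨e, hx, he⟩ := B.exists_trivialization x
    exact ⟨extTrivialization ι he, hx, contMDiffOn_extTrivialization ι he,
      contMDiffOn_extTrivialization_symm ι he,
      fun u hu g => by rw [extTrivialization_act ι he hu]⟩

end Extension

end PrincipalBundle
end PrincipalBundles
end

/-! The idea is to compare all forms after pulling them back along $q\colon P\times H\to P[H]$. A
connection form on $P[H]$ must reproduce $Y$ on the vectors $Tq(0,T_e\lambda_hY)$, which are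
vertical, and right equivariance carries its values at $q(u,e)$ to those at $q(u,h)$. Its pullback
therefore has to be $\Theta(X,Z)=\mu(Z)+\mathrm{Ad}(h^{-1})\kappa(X)$, with $\mu$ the left
Maurer-Cartan form and $\kappa$ the restriction along $u\mapsto q(u,e)$; this is
`PrincipalConnection.form_mfderiv_extMk`.

Conversely, $\Theta$ (`prodForm`) descends for every generalized Cartan connection $\kappa$. If
$\gamma$ is a $G$-valued function, the maps $(f\gamma,b)$ and $(f,\iota(\gamma)b)$ have the same
image under $q$. Equivariance and reproduction of $\kappa$ give a product rule for $\kappa$ along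
$f\gamma$, the logarithmic derivative gives one for $\mu$ along $\iota(\gamma)b$, and together they
show that $\Theta$ agrees on the two maps (`GeneralizedCartanConnection.prodForm_mfderiv_act`). Each
local trivialization of $P$ yields a smooth local section $s$ of $q$, and $s\circ q$ differs from
the identity by such a $\gamma$. Hence $s^*\Theta$ is independent of $s$, is smooth, and pulls back
to $\Theta$ (`GeneralizedCartanConnection.prodForm_extSection`).

Local sections also make $Tq$ surjective onto each tangent space, so a form on $P[H]$ is determined
by its pullback (`extForm_ext`). This gives the uniqueness claim and one composite of the bijection;
the other composite is $\Theta(X,0)=\kappa(X)$ at $h=e$. -/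

noncomputable section

/-! ### Partial derivatives and maps into tangent bundles. -/

section Calculus

variable {EN KN EA KA EB KB EC KC : Type*}
  [NormedAddCommGroup EN] [NormedSpace ℝ EN] [TopologicalSpace KN]
  [NormedAddCommGroup EA] [NormedSpace ℝ EA] [TopologicalSpace KA]
  [NormedAddCommGroup EB] [NormedSpace ℝ EB] [TopologicalSpace KB]
  [NormedAddCommGroup EC] [NormedSpace ℝ EC] [TopologicalSpace KC]
  {IN : ModelWithCorners ℝ EN KN} {IA : ModelWithCorners ℝ EA KA}
  {IB : ModelWithCorners ℝ EB KB} {IC : ModelWithCorners ℝ EC KC}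
  {N A B C : Type*}
  [TopologicalSpace N] [ChartedSpace KN N] [TopologicalSpace A] [ChartedSpace KA A]
  [TopologicalSpace B] [ChartedSpace KB B] [TopologicalSpace C] [ChartedSpace KC C]

/-- The chain rule for a function of two variables, in terms of its partial derivatives. -/
theorem mfderiv_map₂_apply {f : A → B → C} {a : N → A} {b : N → B} {n : N}
    (hf : MDifferentiableAt (IA.prod IB) IC (fun p : A × B => f p.1 p.2) (a n, b n))
    (ha : MDifferentiableAt IN IA a n) (hb : MDifferentiableAt IN IB b n)
    (v : TangentSpace IN n) :
    mfderiv IN IC (fun m => f (a m) (b m)) n v =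
      mfderiv IA IC (fun x => f x (b n)) (a n) (mfderiv IN IA a n v) +
        mfderiv IB IC (fun y => f (a n) y) (b n) (mfderiv IN IB b n v) := by
  have h1 := mfderiv_comp_apply (I := IN) (I' := IA.prod IB) (I'' := IC) n
    (f := fun m => (a m, b m)) hf (ha.prodMk hb) v
  have h2 := mfderiv_prod_eq_add_apply (v := mfderiv IN (IA.prod IB) (fun m => (a m, b m)) n v) hf
  refine h1.trans (h2.trans ?_)
  rw [mfderiv_prodMk ha hb]
  rfl

/-- The partial derivative in the second variable of a smooth function of two variables is smooth,
as a map into the tangent bundle. -/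
theorem contMDiff_partial_tangentMap [IsManifold IA ∞ A] [IsManifold IB ∞ B] [IsManifold IC ∞ C]
    {f : A → B → C} (hf : ContMDiff (IA.prod IB) IC ∞ (fun p : A × B => f p.1 p.2)) :
    ContMDiff (IA.prod IB.tangent) IC.tangent ∞
      (fun p : A × TangentBundle IB B => tangentMap IB IC (f p.1) p.2) := by
  have : IsManifold IA 1 A := IsManifold.of_le (n := ∞) (by simp)
  have : IsManifold IB 1 B := IsManifold.of_le (n := ∞) (by simp)
  have : IsManifold IC 1 C := IsManifold.of_le (n := ∞) (by simp)
  -- The partial derivative is the total derivative restricted to vectors $(0,v)$, so the zero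
  -- section of $TA$ supplies the first component.
  have h1 : ContMDiff (IA.prod IB.tangent) (IA.tangent.prod IB.tangent) ∞
      (fun p : A × TangentBundle IB B =>
        ((Bundle.zeroSection EA (TangentSpace IA) p.1 : TangentBundle IA A), p.2)) :=
    ((Bundle.contMDiff_zeroSection ℝ (TangentSpace IA)).comp contMDiff_fst).prodMk contMDiff_snd
  have h2 := (hf.contMDiff_tangentMap (m := ∞) (by simp)).comp
    ((contMDiff_equivTangentBundleProd_symm (I := IA) (I' := IB) (M := A) (M' := B) (n := ∞)).comp h1)
  convert! h2 using 1
  ext1 ⟨x, v⟩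
  have h4 := mfderiv_prod_eq_add_apply (I := IA) (I' := IB) (I'' := IC)
    (f := fun p : A × B => f p.1 p.2) (p := (x, v.1)) (v := ((0 : EA), (v.2 : EB)))
    (hf.mdifferentiable (by simp) _)
  refine Bundle.TotalSpace.ext rfl (heq_of_eq ?_)
  change mfderiv IB IC (f x) v.1 v.2 = mfderiv (IA.prod IB) IC (fun p : A × B => f p.1 p.2) (x, v.1)
    ((0 : EA), (v.2 : EB))
  rw [h4]
  change _ = mfderiv IA IC (fun z => f z v.1) x (0 : EA) + mfderiv IB IC (f x) v.1 v.2
  erw [map_zero, zero_add]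

/-- A smooth map into the tangent bundle that takes values in a fixed tangent space is smooth as
a map into this vector space. -/
theorem ContMDiff.snd_of_tangentBundle_fiber [IsManifold IC ∞ C] {f : N → TangentBundle IC C}
    (hf : ContMDiff IN IC.tangent ∞ f) {c : C} (hc : ∀ n, (f n).1 = c) :
    ContMDiff (M' := EC) IN 𝓘(ℝ, EC) ∞ (fun n => ((f n).2 : EC)) := by
  have : IsManifold IC 1 C := IsManifold.of_le (n := ∞) (by simp)
  intro n
  have h := ((Bundle.contMDiffAt_totalSpace).1 (hf n)).2
  refine h.congr_of_eventuallyEq (Filter.Eventually.of_forall fun m => ?_)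
  -- Over its own centre $c$ the preferred trivialization is the identity on the fibre; since the
  -- base point never moves, the local coordinate of $f$ is the vector itself.
  have key : ∀ (w : TangentBundle IC C) (c : C), w.1 = c →
      @Eq EC w.2 (trivializationAt EC (TangentSpace IC) c w).2 := by
    rintro ⟨x, w⟩ c rfl
    rw [TangentBundle.trivializationAt_apply]
    exact (tangentCoordChange_self (I := IC) (x := x) (z := x) (v := w)
      (mem_extChartAt_source x)).symm
  exact key (f m) (f n).1 ((hc m).trans (hc n).symm)

end Calculus
end

noncomputable section

/-! ### Adjoint representation and Maurer-Cartan form. -/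

section MaurerCartan

variable {EN KN EG KG EH KH : Type*}
  [NormedAddCommGroup EN] [NormedSpace ℝ EN] [TopologicalSpace KN]
  [NormedAddCommGroup EG] [NormedSpace ℝ EG] [TopologicalSpace KG]
  [NormedAddCommGroup EH] [NormedSpace ℝ EH] [TopologicalSpace KH]
  {IN : ModelWithCorners ℝ EN KN} {IG : ModelWithCorners ℝ EG KG}
  {IH : ModelWithCorners ℝ EH KH} {N G H : Type*}
  [TopologicalSpace N] [ChartedSpace KN N]
  [TopologicalSpace G] [ChartedSpace KG G] [Group G]
  [TopologicalSpace H] [ChartedSpace KH H] [Group H]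

/-- The left Maurer-Cartan form `T_h H → 𝔥`, the derivative at `h` of `k ↦ h⁻¹ k`. -/
def maurerCartan (IH : ModelWithCorners ℝ EH KH) (h : H) :
    TangentSpace IH h →L[ℝ] GroupLieAlgebra IH H :=
  mfderiv IH IH (fun k : H => h⁻¹ * k) h

theorem lieAd_one (Y : GroupLieAlgebra IH H) : lieAd IH (1 : H) Y = Y := by
  have h2 : (fun k : H => (1 : H) * k * (1 : H)⁻¹) = id := by ext k; simp
  unfold lieAd
  rw [h2, mfderiv_id]
  rfl

variable [LieGroup IG ∞ G] [LieGroup IH ∞ H]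

theorem mdifferentiableAt_lie_mul (p : H × H) :
    MDifferentiableAt (IH.prod IH) IH (fun p : H × H => p.1 * p.2) p :=
  (contMDiff_mul IH ∞).mdifferentiable (by simp) p

theorem mdifferentiableAt_lie_mul_left (h k : H) :
    MDifferentiableAt IH IH (fun x : H => h * x) k :=
  (contMDiff_mul_left (I := IH) (n := ∞) (a := h)).mdifferentiable (by simp) k

theorem mdifferentiableAt_lie_mul_right (h k : H) :
    MDifferentiableAt IH IH (fun x : H => x * h) k :=
  (contMDiff_mul_right (I := IH) (n := ∞) (a := h)).mdifferentiable (by simp) k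

theorem contMDiff_conj :
    ContMDiff (IH.prod IH) IH ∞ (fun p : H × H => p.1 * p.2 * p.1⁻¹) :=
  (contMDiff_fst.mul contMDiff_snd).mul contMDiff_fst.inv

theorem mdifferentiableAt_conj (h k : H) :
    MDifferentiableAt IH IH (fun x : H => h * x * h⁻¹) k :=
  ((contMDiff_const.mul contMDiff_id).mul contMDiff_const : ContMDiff IH IH ∞
    (fun x : H => h * x * h⁻¹)).mdifferentiable (by simp) k

/-- `mulInvariantVectorField Y h` is $T_e\lambda_hY$. With the next lemma, this translates between
arbitrary $Z\in T_hH$ and left translates of elements of $\mathfrak h$. -/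
theorem maurerCartan_mulInvariantVectorField (h : H) (Y : GroupLieAlgebra IH H) :
    maurerCartan IH h (mulInvariantVectorField Y h) = Y := by
  have h1 := mfderiv_comp_apply_of_eq (I := IH) (I' := IH) (I'' := IH) (1 : H)
    (g := fun k : H => h⁻¹ * k) (f := fun k : H => h * k) (y := h)
    (mdifferentiableAt_lie_mul_left _ _) (mdifferentiableAt_lie_mul_left _ _) (mul_one h) Y
  refine Eq.trans h1.symm ?_
  have h2 : (fun k : H => h⁻¹ * k) ∘ (fun k : H => h * k) = id := by ext k; simp
  rw [h2, mfderiv_id]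
  rfl

theorem mulInvariantVectorField_maurerCartan (h : H) (Z : TangentSpace IH h) :
    mulInvariantVectorField (maurerCartan IH h Z) h = Z := by
  have h1 := mfderiv_comp_apply_of_eq (I := IH) (I' := IH) (I'' := IH) h
    (f := fun k : H => h⁻¹ * k) (g := fun k : H => h * k) (y := 1)
    (mdifferentiableAt_lie_mul_left _ _) (mdifferentiableAt_lie_mul_left _ _) (inv_mul_cancel h) Z
  refine Eq.trans h1.symm ?_
  have h2 : (fun k : H => h * k) ∘ (fun k : H => h⁻¹ * k) = id := by ext k; simp
  rw [h2, mfderiv_id]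
  rfl

theorem lieAd_mul (h k : H) (Y : GroupLieAlgebra IH H) :
    lieAd IH (h * k) Y = lieAd IH h (lieAd IH k Y) := by
  have h1 := mfderiv_comp_apply_of_eq (I := IH) (I' := IH) (I'' := IH) (1 : H)
    (g := fun x : H => h * x * h⁻¹) (f := fun x : H => k * x * k⁻¹) (y := 1)
    (mdifferentiableAt_conj _ _) (mdifferentiableAt_conj _ _) (by simp) Y
  refine Eq.trans ?_ h1
  have h2 : (fun x : H => h * x * h⁻¹) ∘ (fun x : H => k * x * k⁻¹) =
      fun x : H => (h * k) * x * (h * k)⁻¹ := by ext x; simp [mul_assoc]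
  rw [h2]
  rfl

/-- The Maurer-Cartan form is right equivariant. -/
theorem maurerCartan_mfderiv_mul_right (h k : H) (Z : TangentSpace IH h) :
    maurerCartan IH (h * k) (mfderiv IH IH (fun x : H => x * k) h Z) =
      lieAd IH k⁻¹ (maurerCartan IH h Z) := by
  have h1 := mfderiv_comp_apply (I := IH) (I' := IH) (I'' := IH) h
    (g := fun x : H => (h * k)⁻¹ * x) (f := fun x : H => x * k)
    (mdifferentiableAt_lie_mul_left _ _) (mdifferentiableAt_lie_mul_right _ _) Z
  have h2 := mfderiv_comp_apply_of_eq (I := IH) (I' := IH) (I'' := IH) h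
    (g := fun x : H => k⁻¹ * x * k⁻¹⁻¹) (f := fun x : H => h⁻¹ * x) (y := 1)
    (mdifferentiableAt_conj _ _) (mdifferentiableAt_lie_mul_left _ _) (by simp) Z
  refine Eq.trans h1.symm (Eq.trans ?_ h2)
  have h3 : (fun x : H => (h * k)⁻¹ * x) ∘ (fun x : H => x * k) =
      (fun x : H => k⁻¹ * x * k⁻¹⁻¹) ∘ (fun x : H => h⁻¹ * x) := by ext x; simp [mul_assoc]
  rw [h3]

/-- The Maurer-Cartan form is left invariant. -/
theorem maurerCartan_mfderiv_mul_left (h k : H) (Z : TangentSpace IH k) :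
    maurerCartan IH (h * k) (mfderiv IH IH (fun x : H => h * x) k Z) = maurerCartan IH k Z := by
  have h1 := mfderiv_comp_apply (I := IH) (I' := IH) (I'' := IH) k
    (g := fun x : H => (h * k)⁻¹ * x) (f := fun x : H => h * x)
    (mdifferentiableAt_lie_mul_left _ _) (mdifferentiableAt_lie_mul_left _ _) Z
  refine Eq.trans h1.symm ?_
  have h3 : (fun x : H => (h * k)⁻¹ * x) ∘ (fun x : H => h * x) =
      (fun x : H => k⁻¹ * x) := by ext x; simp [mul_assoc]
  rw [h3]
  rfl

/-- The product rule for the logarithmic derivative of maps into a Lie group. -/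
theorem maurerCartan_mfderiv_mul {a b : N → H} {n : N} (ha : MDifferentiableAt IN IH a n)
    (hb : MDifferentiableAt IN IH b n) (v : TangentSpace IN n) :
    maurerCartan IH (a n * b n) (mfderiv IN IH (fun m => a m * b m) n v) =
      lieAd IH (b n)⁻¹ (maurerCartan IH (a n) (mfderiv IN IH a n v)) +
        maurerCartan IH (b n) (mfderiv IN IH b n v) := by
  have h1 := mfderiv_map₂_apply (f := fun x y : H => x * y) (mdifferentiableAt_lie_mul _) ha hb v
  rw [h1, map_add, maurerCartan_mfderiv_mul_right, maurerCartan_mfderiv_mul_left]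

/-- The Maurer-Cartan forms are compatible with homomorphisms of Lie groups. -/
theorem maurerCartan_mfderiv_hom (ι : ContMDiffMonoidMorphism IG IH ∞ G H) (g : G)
    (V : TangentSpace IG g) :
    maurerCartan IH (ι g) (mfderiv IG IH ι g V) = mfderiv IG IH ι 1 (maurerCartan IG g V) := by
  have hι : MDifferentiable IG IH ι := ι.contMDiff_toFun.mdifferentiable (by simp)
  have h1 := mfderiv_comp_apply (I := IG) (I' := IH) (I'' := IH) g
    (g := fun x : H => (ι g)⁻¹ * x) (f := ι) (mdifferentiableAt_lie_mul_left _ _) (hι _) V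
  have h2 := mfderiv_comp_apply_of_eq (I := IG) (I' := IG) (I'' := IH) g
    (g := ι) (f := fun x : G => g⁻¹ * x) (y := 1)
    (hι _) (mdifferentiableAt_lie_mul_left _ _) (by simp) V
  refine Eq.trans h1.symm (Eq.trans ?_ h2)
  have h3 : (fun x : H => (ι g)⁻¹ * x) ∘ ι = ι ∘ (fun x : G => g⁻¹ * x) := by ext x; simp
  rw [h3]

/-- This is the partial derivative of multiplication in the second variable, evaluated at
$(h^{-1},v)$ with $v\in T_hH$. All values lie over $h^{-1}h=1$, hence in one fixed vector space. -/
theorem contMDiff_maurerCartan :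
    ContMDiff (M' := EH) IH.tangent 𝓘(ℝ, EH) ∞
      (fun v : TangentBundle IH H => maurerCartan IH v.1 v.2) := by
  have h1 := contMDiff_partial_tangentMap (IA := IH) (IB := IH) (IC := IH)
    (f := fun x y : H => x * y) (contMDiff_mul IH ∞)
  have h2 : ContMDiff IH.tangent (IH.prod IH.tangent) ∞
      (fun v : TangentBundle IH H => ((v.1)⁻¹, v)) :=
    ((Bundle.contMDiff_proj (TangentSpace IH)).inv).prodMk contMDiff_id
  exact (h1.comp h2).snd_of_tangentBundle_fiber (c := (1 : H)) (fun v => inv_mul_cancel v.1)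

/-- The same argument with conjugation in place of multiplication, applied to vectors based at $1$,
which conjugation fixes. -/
theorem contMDiff_lieAd :
    ContMDiff (M' := EH) (IH.prod 𝓘(ℝ, EH)) 𝓘(ℝ, EH) ∞
      (fun p : H × EH => lieAd IH p.1 p.2) := by
  have h1 := contMDiff_partial_tangentMap (IA := IH) (IB := IH) (IC := IH)
    (f := fun x y : H => x * y * x⁻¹) contMDiff_conj
  have h2 : ContMDiff (IH.prod 𝓘(ℝ, EH)) (IH.prod IH.tangent) ∞
      (fun p : H × EH => (p.1, (⟨1, p.2⟩ : TangentBundle IH H))) := by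
    refine contMDiff_fst.prodMk fun p => ?_
    refine (Bundle.contMDiffAt_totalSpace).2 ⟨contMDiffAt_const, ?_⟩
    refine contMDiffAt_snd.congr_of_eventuallyEq (Filter.Eventually.of_forall fun m => ?_)
    change (trivializationAt EH (TangentSpace IH) (1 : H) ⟨1, m.2⟩).2 = m.2
    rw [TangentBundle.trivializationAt_apply]
    exact tangentCoordChange_self (I := IH) (x := (1 : H)) (z := (1 : H)) (v := m.2)
      (mem_extChartAt_source _)
  exact (h1.comp h2).snd_of_tangentBundle_fiber (c := (1 : H)) (fun v => by simp [tangentMap])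

end MaurerCartan
end

noncomputable section

namespace PrincipalBundle

/-! ### The form on $P\times H$ and its invariance under $G$. -/

section Extension

variable {EN KN EP KP EM KM EG KG EH KH : Type*}
  [NormedAddCommGroup EN] [NormedSpace ℝ EN] [TopologicalSpace KN]
  [NormedAddCommGroup EP] [NormedSpace ℝ EP] [TopologicalSpace KP]
  [NormedAddCommGroup EM] [NormedSpace ℝ EM] [TopologicalSpace KM]
  [NormedAddCommGroup EG] [NormedSpace ℝ EG] [TopologicalSpace KG]
  [NormedAddCommGroup EH] [NormedSpace ℝ EH] [TopologicalSpace KH]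
  {IN : ModelWithCorners ℝ EN KN}
  {IP : ModelWithCorners ℝ EP KP} {IM : ModelWithCorners ℝ EM KM}
  {IG : ModelWithCorners ℝ EG KG} {IH : ModelWithCorners ℝ EH KH}
  {N P M G H : Type*}
  [TopologicalSpace N] [ChartedSpace KN N]
  [TopologicalSpace P] [ChartedSpace KP P]
  [TopologicalSpace M] [ChartedSpace KM M]
  [TopologicalSpace G] [ChartedSpace KG G] [Group G]
  [TopologicalSpace H] [ChartedSpace KH H] [Group H]

/-- The one-form `(X, Z) ↦ μ(Z) + Ad(h⁻¹) α(X)` on `P × H`, where `μ` is the Maurer-Cartan form. -/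
def prodForm (α : ∀ u : P, TangentSpace IP u →L[ℝ] GroupLieAlgebra IH H) (p : P × H) :
    TangentSpace (IP.prod IH) p →L[ℝ] GroupLieAlgebra IH H :=
  (maurerCartan IH p.2).comp (mfderiv (IP.prod IH) IH Prod.snd p) +
    (lieAd IH p.2⁻¹).comp ((α p.1).comp (mfderiv (IP.prod IH) IP Prod.fst p))

theorem prodForm_apply (α : ∀ u : P, TangentSpace IP u →L[ℝ] GroupLieAlgebra IH H) (u : P) (h : H)
    (X : TangentSpace IP u) (Z : TangentSpace IH h) :
    prodForm α (u, h) (X, Z) = maurerCartan IH h Z + lieAd IH h⁻¹ (α u X) := by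
  unfold prodForm
  rw [mfderiv_fst, mfderiv_snd]
  rfl

theorem prodForm_mfderiv (α : ∀ u : P, TangentSpace IP u →L[ℝ] GroupLieAlgebra IH H)
    {f : N → P} {b : N → H} {n : N} (hf : MDifferentiableAt IN IP f n)
    (hb : MDifferentiableAt IN IH b n) (v : TangentSpace IN n) :
    prodForm α (f n, b n) (mfderiv IN (IP.prod IH) (fun m => (f m, b m)) n v) =
      maurerCartan IH (b n) (mfderiv IN IH b n v) +
        lieAd IH (b n)⁻¹ (α (f n) (mfderiv IN IP f n v)) := by
  rw [mfderiv_prodMk hf hb]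
  exact prodForm_apply α (f n) (b n) _ _

/-- All tangent spaces unfold to the model space `EP`, so one vector can be read at two
propositionally equal points without a cast. -/
theorem form_congr_point {F : Type*} [AddCommGroup F] [Module ℝ F] [TopologicalSpace F]
    (α : ∀ u : P, TangentSpace IP u →L[ℝ] F) {u u' : P} (h : u = u') (v : EP) :
    α u v = α u' v := by
  subst h; rfl

/-- One-forms take equal values on the derivatives of maps with the same germ. -/
theorem form_mfderiv_congr {F : Type*} [AddCommGroup F] [Module ℝ F] [TopologicalSpace F]
    (α : ∀ u : P, TangentSpace IP u →L[ℝ] F)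
    {f g : N → P} {n : N} (h : f =ᶠ[𝓝 n] g) (v : TangentSpace IN n) :
    α (f n) (mfderiv IN IP f n v) = α (g n) (mfderiv IN IP g n v) := by
  have h1 : @Eq (EN →L[ℝ] EP) (mfderiv IN IP f n) (mfderiv IN IP g n) := h.mfderiv_eq
  exact (congrArg (fun A : EN →L[ℝ] EP => α (f n) (A v)) h1).trans
    (form_congr_point α h.eq_of_nhds _)

/-- Write $u\cdot x=(u\cdot g)\cdot(g^{-1}x)$ and differentiate at $x=g$: every vector tangent to an
orbit is a value of a fundamental field, so the reproduction property applies to it. -/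
theorem mfderiv_act_right (B : PrincipalBundle IP IM IG P M G) [LieGroup IG ∞ G] (u : P) (g : G)
    (V : TangentSpace IG g) :
    mfderiv IG IP (fun x : G => B.act u x) g V =
      B.fundamental (maurerCartan IG g V) (B.act u g) := by
  have hB : ∀ u x, MDifferentiableAt IG IP (fun x : G => B.act u x) x := fun u x =>
    (B.contMDiff_act.comp (contMDiff_const.prodMk contMDiff_id)).mdifferentiable (by simp) x
  have h1 := mfderiv_comp_apply_of_eq (I := IG) (I' := IG) (I'' := IP) g
    (g := fun x : G => B.act (B.act u g) x) (f := fun x : G => g⁻¹ * x) (y := 1)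
    (hB _ _) (mdifferentiableAt_lie_mul_left _ _) (inv_mul_cancel g) V
  refine Eq.trans ?_ h1
  have h2 : (fun x : G => B.act (B.act u g) x) ∘ (fun x : G => g⁻¹ * x) =
      fun x : G => B.act u x := by
    ext x; simp [← B.act_mul]
  rw [h2]

variable [LieGroup IG ∞ G] [LieGroup IH ∞ H] {B : PrincipalBundle IP IM IG P M G}

/-- The product rule for $\kappa$ along $f\cdot\gamma$: equivariance evaluates the variation of $f$,
and reproduction evaluates the variation of $\gamma$. -/
theorem GeneralizedCartanConnection.form_mfderiv_act [IsManifold IP ∞ P]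
    {ι : ContMDiffMonoidMorphism IG IH ∞ G H} (κ : B.GeneralizedCartanConnection ι)
    {f : N → P} {γ : N → G} {n : N} (hf : MDifferentiableAt IN IP f n)
    (hγ : MDifferentiableAt IN IG γ n) (v : TangentSpace IN n) :
    κ.form (B.act (f n) (γ n)) (mfderiv IN IP (fun m => B.act (f m) (γ m)) n v) =
      lieAd IH (ι (γ n))⁻¹ (κ.form (f n) (mfderiv IN IP f n v)) +
        maurerCartan IH (ι (γ n)) (mfderiv IN IH (fun m => ι (γ m)) n v) := by
  have h1 := mfderiv_map₂_apply (f := B.act) (B.contMDiff_act.mdifferentiable (by simp) _) hf hγ v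
  have hι : MDifferentiable IG IH ι := ι.contMDiff_toFun.mdifferentiable (by simp)
  have h2 := mfderiv_comp_apply (I := IN) (I' := IG) (I'' := IH) n (hι _) hγ v
  rw [h1, map_add, κ.equivariant, mfderiv_act_right, κ.reproduces, map_inv]
  congr 1
  rw [← maurerCartan_mfderiv_hom]
  exact congrArg (maurerCartan IH (ι (γ n))) h2.symm

/-- The form `prodForm κ.form` is basic for the action of `G` on `P × H`: it does not distinguish
between maps that differ by a `G`-valued function. -/
theorem GeneralizedCartanConnection.prodForm_mfderiv_act [IsManifold IP ∞ P]
    {ι : ContMDiffMonoidMorphism IG IH ∞ G H} (κ : B.GeneralizedCartanConnection ι)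
    {f : N → P} {γ : N → G} {b : N → H} {n : N} (hf : MDifferentiableAt IN IP f n)
    (hγ : MDifferentiableAt IN IG γ n) (hb : MDifferentiableAt IN IH b n)
    (v : TangentSpace IN n) :
    prodForm κ.form (B.act (f n) (γ n), b n)
        (mfderiv IN (IP.prod IH) (fun m => (B.act (f m) (γ m), b m)) n v) =
      prodForm κ.form (f n, ι (γ n) * b n)
        (mfderiv IN (IP.prod IH) (fun m => (f m, ι (γ m) * b m)) n v) := by
  have hι : MDifferentiable IG IH ι := ι.contMDiff_toFun.mdifferentiable (by simp)
  have hιγ : MDifferentiableAt IN IH (fun m => ι (γ m)) n := (hι _).comp n hγ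
  have hact : MDifferentiableAt IN IP (fun m => B.act (f m) (γ m)) n :=
    (B.contMDiff_act.mdifferentiable (by simp) (f n, γ n)).comp n (hf.prodMk hγ)
  have hmul : MDifferentiableAt IN IH (fun m => ι (γ m) * b m) n :=
    (mdifferentiableAt_lie_mul (ι (γ n), b n)).comp n (hιγ.prodMk hb)
  have h1 := prodForm_mfderiv κ.form hact hb v
  have h2 := prodForm_mfderiv κ.form hf hmul v
  -- Both sides become the same three terms: the derivative of $b$, that of $\iota\circ\gamma$
  -- twisted by $\mathrm{Ad}(b^{-1})$, and $\kappa(f')$ twisted by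
  -- $\mathrm{Ad}(b^{-1})\mathrm{Ad}(\iota(\gamma)^{-1})$.
  rw [h1, h2, κ.form_mfderiv_act hf hγ, maurerCartan_mfderiv_mul hιγ hb, mul_inv_rev, lieAd_mul,
    map_add]
  abel

theorem contMDiff_prodForm [IsManifold IP ∞ P]
    {α : ∀ u : P, TangentSpace IP u →L[ℝ] GroupLieAlgebra IH H}
    (hα : ContMDiff (M' := EH) IP.tangent 𝓘(ℝ, EH) ∞ fun v : TangentBundle IP P => α v.1 v.2) :
    ContMDiff (M' := EH) (IP.prod IH).tangent 𝓘(ℝ, EH) ∞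
      fun v : TangentBundle (IP.prod IH) (P × H) => prodForm α v.1 v.2 := by
  have : IsManifold IP 1 P := IsManifold.of_le (n := ∞) (by simp)
  have : IsManifold IH 1 H := IsManifold.of_le (n := ∞) (by simp)
  have h1 := (contMDiff_fst (I := IP) (J := IH) (M := P) (N := H) (n := ∞)).contMDiff_tangentMap
    (m := ∞) (by simp)
  have h2 := (contMDiff_snd (I := IP) (J := IH) (M := P) (N := H) (n := ∞)).contMDiff_tangentMap
    (m := ∞) (by simp)
  have h3 := (contMDiff_maurerCartan (IH := IH) (H := H)).comp h2
  have h4 : ContMDiff (IP.prod IH).tangent IH ∞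
      (fun v : TangentBundle (IP.prod IH) (P × H) => v.1.2⁻¹) :=
    (contMDiff_snd.comp (Bundle.contMDiff_proj (TangentSpace (IP.prod IH)))).inv
  have h5 := (contMDiff_lieAd (IH := IH) (H := H)).comp (h4.prodMk (hα.comp h1))
  exact h3.add h5

end Extension
end PrincipalBundle
end

noncomputable section

namespace PrincipalBundle

/-! ### Local sections of $q$ and descent to $P[H]$. -/

section Extension

variable {EN KN EP KP EM KM EG KG EH KH : Type*}
  [NormedAddCommGroup EN] [NormedSpace ℝ EN] [TopologicalSpace KN]
  [NormedAddCommGroup EP] [NormedSpace ℝ EP] [TopologicalSpace KP]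
  [NormedAddCommGroup EM] [NormedSpace ℝ EM] [TopologicalSpace KM]
  [NormedAddCommGroup EG] [NormedSpace ℝ EG] [TopologicalSpace KG]
  [NormedAddCommGroup EH] [NormedSpace ℝ EH] [TopologicalSpace KH]
  {IN : ModelWithCorners ℝ EN KN}
  {IP : ModelWithCorners ℝ EP KP} {IM : ModelWithCorners ℝ EM KM}
  {IG : ModelWithCorners ℝ EG KG} {IH : ModelWithCorners ℝ EH KH}
  {N P M G H : Type*}
  [TopologicalSpace N] [ChartedSpace KN N]
  [TopologicalSpace P] [ChartedSpace KP P]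
  [TopologicalSpace M] [ChartedSpace KM M]
  [TopologicalSpace G] [ChartedSpace KG G] [Group G]
  [TopologicalSpace H] [ChartedSpace KH H] [Group H]

variable {B : PrincipalBundle IP IM IG P M G} (ι : ContMDiffMonoidMorphism IG IH ∞ G H)
  {e : Bundle.Trivialization G B.proj}

theorem isOpen_extProj_preimage : IsOpen (B.extProj ι ⁻¹' e.baseSet) :=
  e.open_baseSet.preimage (B.continuous_extProj ι)

theorem contMDiffOn_trivialization_section (he : IsPrincipalTrivialization IP IM IG B.act e) :
    ContMDiffOn IM IP ∞ (fun x => e.toOpenPartialHomeomorph.symm (x, 1)) e.baseSet := by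
  refine he.contMDiffOn_symm.comp (contMDiff_id.prodMk contMDiff_const).contMDiffOn ?_
  intro x hx
  rw [Set.mem_preimage, e.target_eq]
  exact ⟨hx, trivial⟩

variable [LieGroup IH ∞ H]

/-- The section of `q : P × H → P[H]` over a trivializing open set, given by the section of `P`
that corresponds to the unit of `G`. -/
def extSection (he : IsPrincipalTrivialization IP IM IG B.act e) (y : B.Ext ι) : P × H :=
  (e.toOpenPartialHomeomorph.symm (B.extProj ι y, 1), (extTrivialization ι he y).2)

theorem extMk_extSection (he : IsPrincipalTrivialization IP IM IG B.act e) {y : B.Ext ι}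
    (hy : B.extProj ι y ∈ e.baseSet) : B.extMk ι (extSection ι he y) = y := by
  have h := (extTrivialization ι he).toOpenPartialHomeomorph.left_inv
    (x := y) ((extTrivialization ι he).mem_source.2 hy)
  have h1 := (extTrivialization ι he).coe_fst ((extTrivialization ι he).mem_source.2 hy)
  refine Eq.trans ?_ h
  refine congrArg (B.extMk ι) ?_
  unfold extSection
  rw [← h1]
  rfl

/-- The representative picked by the section differs from $(u,h)$ by the group element $\gamma(u)$,
the fibre coordinate of $u$. -/
theorem extSection_extMk (he : IsPrincipalTrivialization IP IM IG B.act e) {u : P}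
    (hu : B.proj u ∈ e.baseSet) (h : H) :
    extSection ι he (B.extMk ι (u, h)) =
      (e.toOpenPartialHomeomorph.symm (B.proj u, 1), ι (e u).2 * h) := by
  unfold extSection
  rw [extTrivialization_mk ι he hu]
  rfl

variable [IsManifold IM ∞ M]

theorem contMDiffOn_extSection (he : IsPrincipalTrivialization IP IM IG B.act e) :
    ContMDiffOn (IM.prod IH) (IP.prod IH) ∞ (extSection ι he) (B.extProj ι ⁻¹' e.baseSet) := by
  refine ContMDiffOn.prodMk ?_ ?_
  · exact (contMDiffOn_trivialization_section he).comp
      (B.extend ι).contMDiff_proj.contMDiffOn fun y hy => hy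
  · exact contMDiff_snd.comp_contMDiffOn (contMDiffOn_extTrivialization ι he)

theorem mdifferentiableAt_extSection (he : IsPrincipalTrivialization IP IM IG B.act e)
    {y : B.Ext ι} (hy : B.extProj ι y ∈ e.baseSet) :
    MDifferentiableAt (IM.prod IH) (IP.prod IH) (extSection ι he) y :=
  ((contMDiffOn_extSection ι he).contMDiffAt
    ((isOpen_extProj_preimage ι).mem_nhds hy)).mdifferentiableAt (by simp)

variable (B) in
-- In the induced trivialization $q$ reads $(u,h)\mapsto(\pi(u),\iota(\gamma(u))h)$, which is
-- smooth.
theorem contMDiff_extMk : ContMDiff (IP.prod IH) (IM.prod IH) ∞ (B.extMk ι) := by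
  rintro ⟨u, h⟩
  obtain ⟨e, hu, he⟩ := B.exists_trivialization (B.proj u)
  have ho : IsOpen ((fun p : P × H => B.proj p.1) ⁻¹' e.baseSet) :=
    e.open_baseSet.preimage (B.contMDiff_proj.continuous.comp continuous_fst)
  have h1 : ContMDiffOn (IP.prod IH) (IM.prod IH) ∞
      (fun p : P × H => (B.proj p.1, ι (e p.1).2 * p.2))
      ((fun p : P × H => B.proj p.1) ⁻¹' e.baseSet) := by
    refine (B.contMDiff_proj.comp contMDiff_fst).contMDiffOn.prodMk
      (ContMDiffOn.mul ?_ contMDiffOn_snd)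
    exact ι.contMDiff_toFun.comp_contMDiffOn (contMDiff_snd.comp_contMDiffOn
      (he.contMDiffOn.comp contMDiffOn_fst fun p hp => e.mem_source.2 hp))
  have h2 := (contMDiffOn_extTrivialization_symm ι he).comp h1 fun p hp => ⟨hp, trivial⟩
  refine (h2.contMDiffAt (ho.mem_nhds hu)).congr_of_eventuallyEq ?_
  filter_upwards [ho.mem_nhds hu] with p hp
  have h3 := (extTrivialization ι he).toOpenPartialHomeomorph.left_inv
    (x := B.extMk ι p) ((extTrivialization ι he).mem_source.2 hp)
  exact h3.symm.trans (congrArg _ (extTrivialization_mk ι he hp p.2))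

variable (B) in
theorem mdifferentiable_extMk : MDifferentiable (IP.prod IH) (IM.prod IH) (B.extMk ι) :=
  (B.contMDiff_extMk ι).mdifferentiable (by simp)

theorem mfderiv_extMk_mfderiv_extSection (he : IsPrincipalTrivialization IP IM IG B.act e)
    {y : B.Ext ι} (hy : B.extProj ι y ∈ e.baseSet) (v : TangentSpace (IM.prod IH) y) :
    mfderiv (IP.prod IH) (IM.prod IH) (B.extMk ι) (extSection ι he y)
      (mfderiv (IM.prod IH) (IP.prod IH) (extSection ι he) y v) = v := by
  have h1 := mfderiv_comp_apply (I := IM.prod IH) (I' := IP.prod IH) (I'' := IM.prod IH) y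
    (B.mdifferentiable_extMk ι _) (mdifferentiableAt_extSection ι he hy) v
  refine h1.symm.trans ?_
  have h2 : B.extMk ι ∘ extSection ι he =ᶠ[𝓝 y] id := by
    filter_upwards [(isOpen_extProj_preimage ι).mem_nhds hy] with z hz
    exact extMk_extSection ι he hz
  rw [h2.mfderiv_eq, mfderiv_id]
  rfl

/-- Every tangent vector of `P[H]` is the image of a tangent vector of `P × H`. -/
theorem exists_mfderiv_extMk (y : B.Ext ι) : ∃ (u : P) (h : H), B.extMk ι (u, h) = y ∧
    ∀ v : EM × EH, ∃ (X : TangentSpace IP u) (Y : GroupLieAlgebra IH H),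
      @Eq (EM × EH) (mfderiv (IP.prod IH) (IM.prod IH) (B.extMk ι) (u, h)
        (X, mulInvariantVectorField Y h)) v := by
  obtain ⟨e, hy, he⟩ := B.exists_trivialization (B.extProj ι y)
  refine ⟨(extSection ι he y).1, (extSection ι he y).2, extMk_extSection ι he hy, fun v => ?_⟩
  have h1 := mfderiv_extMk_mfderiv_extSection ι he hy v
  set w : EP × EH := mfderiv (IM.prod IH) (IP.prod IH) (extSection ι he) y v
  -- The lift of $v$ is its image under the derivative of the section; its $H$-component is
  -- rewritten as a left translate.
  refine ⟨w.1, maurerCartan IH (extSection ι he y).2 w.2, ?_⟩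
  refine Eq.trans ?_ h1
  exact congrArg (fun Z : EH => mfderiv (IP.prod IH) (IM.prod IH) (B.extMk ι) (extSection ι he y)
    (w.1, Z)) (mulInvariantVectorField_maurerCartan (extSection ι he y).2 w.2)

/-- Two families of linear maps on the tangent spaces of `P[H]` agree if their pullbacks to
`P × H` do. -/
theorem extForm_ext {F : Type*} [AddCommGroup F] [Module ℝ F] [TopologicalSpace F]
    {θ θ' : ∀ y : B.Ext ι, TangentSpace (IM.prod IH) y →L[ℝ] F}
    (h : ∀ (u : P) (h : H) (X : TangentSpace IP u) (Y : GroupLieAlgebra IH H),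
      θ (B.extMk ι (u, h)) (mfderiv (IP.prod IH) (IM.prod IH) (B.extMk ι) (u, h)
          (X, mulInvariantVectorField Y h)) =
        θ' (B.extMk ι (u, h)) (mfderiv (IP.prod IH) (IM.prod IH) (B.extMk ι) (u, h)
          (X, mulInvariantVectorField Y h))) : θ = θ' := by
  funext y
  obtain ⟨u, k, rfl, hs⟩ := exists_mfderiv_extMk ι y
  refine ContinuousLinearMap.ext fun v => ?_
  obtain ⟨X, Y, hv⟩ := hs v
  have := h u k X Y
  rwa [hv] at this

variable {ι} [LieGroup IG ∞ G] [IsManifold IP ∞ P]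

/-- The pullback of `prodForm κ.form` along a local section does not depend on the section. -/
theorem GeneralizedCartanConnection.prodForm_extSection (κ : B.GeneralizedCartanConnection ι)
    (he : IsPrincipalTrivialization IP IM IG B.act e) {u : P} (hu : B.proj u ∈ e.baseSet) (h : H)
    (w : TangentSpace (IP.prod IH) (u, h)) :
    prodForm κ.form (extSection ι he (B.extMk ι (u, h)))
      (mfderiv (IM.prod IH) (IP.prod IH) (extSection ι he) (B.extMk ι (u, h))
        (mfderiv (IP.prod IH) (IM.prod IH) (B.extMk ι) (u, h) w)) = prodForm κ.form (u, h) w := by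
  have ho : (fun p : P × H => B.proj p.1) ⁻¹' e.baseSet ∈ 𝓝 (u, h) :=
    (e.open_baseSet.preimage (B.contMDiff_proj.continuous.comp continuous_fst)).mem_nhds hu
  have hf : MDifferentiableAt (IP.prod IH) IP
      (fun p : P × H => e.toOpenPartialHomeomorph.symm (B.proj p.1, 1)) (u, h) :=
    (((contMDiffOn_trivialization_section he).comp
      (B.contMDiff_proj.comp contMDiff_fst).contMDiffOn fun p hp => hp).contMDiffAt
        ho).mdifferentiableAt (by simp)
  have hγ : MDifferentiableAt (IP.prod IH) IG (fun p : P × H => (e p.1).2) (u, h) :=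
    ((contMDiff_snd.comp_contMDiffOn (he.contMDiffOn.comp
      (contMDiffOn_fst (I := IP) (J := IH) (M := P) (N := H))
        fun p hp => e.mem_source.2 hp)).contMDiffAt ho).mdifferentiableAt (by simp)
  -- With $f=\sigma\circ\pi$, where $\sigma$ is the unit section of the trivialization, and $\gamma$
  -- the fibre coordinate, $(f\gamma,h)$ is locally the identity (`h4`) and $(f,\iota(\gamma)h)$ is
  -- locally $s\circ q$ (`h3`).
  have h1 := κ.prodForm_mfderiv_act hf hγ mdifferentiableAt_snd w
  have h2 := mfderiv_comp_apply (I := IP.prod IH) (I' := IM.prod IH) (I'' := IP.prod IH) (u, h)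
    (mdifferentiableAt_extSection ι he (y := B.extMk ι (u, h)) hu) (B.mdifferentiable_extMk ι _) w
  have h3 : extSection ι he ∘ B.extMk ι =ᶠ[𝓝 (u, h)] fun p : P × H =>
      (e.toOpenPartialHomeomorph.symm (B.proj p.1, 1), ι (e p.1).2 * p.2) := by
    filter_upwards [ho] with p hp
    exact extSection_extMk ι he hp p.2
  have h4 : (fun p : P × H => (B.act (e.toOpenPartialHomeomorph.symm (B.proj p.1, 1)) (e p.1).2,
      p.2)) =ᶠ[𝓝 (u, h)] id := by
    filter_upwards [ho] with p hp
    rw [trivialization_inv_act he hp]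
    rfl
  have h5 := form_mfderiv_congr (IN := IP.prod IH) (prodForm κ.form) h3 w
  have h6 := form_mfderiv_congr (IN := IP.prod IH) (prodForm κ.form) h4 w
  rw [mfderiv_id] at h6
  refine Eq.trans ?_ (h5.trans (h1.symm.trans h6))
  exact congrArg (prodForm κ.form (extSection ι he (B.extMk ι (u, h)))) h2.symm

/-- The one-form on `P[H]` whose pullback to `P × H` is `prodForm κ.form`. -/
def GeneralizedCartanConnection.extForm (κ : B.GeneralizedCartanConnection ι) (y : B.Ext ι) :
    TangentSpace (IM.prod IH) y →L[ℝ] GroupLieAlgebra IH H :=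
  (prodForm κ.form (extSection ι (B.exists_trivialization (B.extProj ι y)).choose_spec.2 y)).comp
    (mfderiv (IM.prod IH) (IP.prod IH)
      (extSection ι (B.exists_trivialization (B.extProj ι y)).choose_spec.2) y)

theorem GeneralizedCartanConnection.extForm_mfderiv_extMk (κ : B.GeneralizedCartanConnection ι)
    (p : P × H) (w : TangentSpace (IP.prod IH) p) :
    κ.extForm (B.extMk ι p) (mfderiv (IP.prod IH) (IM.prod IH) (B.extMk ι) p w) =
      prodForm κ.form p w :=
  κ.prodForm_extSection _ (B.exists_trivialization (B.extProj ι (B.extMk ι p))).choose_spec.1 p.2 w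

theorem GeneralizedCartanConnection.extForm_mfderiv_extMk_apply
    (κ : B.GeneralizedCartanConnection ι) (u : P) (h : H) (X : TangentSpace IP u)
    (Y : GroupLieAlgebra IH H) :
    κ.extForm (B.extMk ι (u, h)) (mfderiv (IP.prod IH) (IM.prod IH) (B.extMk ι) (u, h)
      (X, mulInvariantVectorField Y h)) = Y + lieAd IH h⁻¹ (κ.form u X) := by
  have h1 := κ.extForm_mfderiv_extMk (u, h) (X, mulInvariantVectorField Y h)
  rw [h1, prodForm_apply, maurerCartan_mulInvariantVectorField]

/-- The definition of `extForm` chooses a trivialization separately at each point. This allows one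
fixed trivialization on a whole open set, as smoothness requires. -/
theorem GeneralizedCartanConnection.extForm_eq (κ : B.GeneralizedCartanConnection ι)
    (he : IsPrincipalTrivialization IP IM IG B.act e) {y : B.Ext ι}
    (hy : B.extProj ι y ∈ e.baseSet) (v : TangentSpace (IM.prod IH) y) :
    κ.extForm y v = prodForm κ.form (extSection ι he y)
      (mfderiv (IM.prod IH) (IP.prod IH) (extSection ι he) y v) := by
  have h1 := κ.extForm_mfderiv_extMk (extSection ι he y)
    (mfderiv (IM.prod IH) (IP.prod IH) (extSection ι he) y v)
  rw [← h1, mfderiv_extMk_mfderiv_extSection ι he hy]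
  exact form_congr_point κ.extForm (extMk_extSection ι he hy).symm v

theorem GeneralizedCartanConnection.contMDiff_extForm (κ : B.GeneralizedCartanConnection ι) :
    ContMDiff (M' := EH) (IM.prod IH).tangent 𝓘(ℝ, EH) ∞
      fun v : TangentBundle (IM.prod IH) (B.Ext ι) => κ.extForm v.1 v.2 := by
  have : IsManifold IP 1 P := IsManifold.of_le (n := ∞) (by simp)
  have : IsManifold IH 1 H := IsManifold.of_le (n := ∞) (by simp)
  have : IsManifold (IM.prod IH) 1 (B.Ext ι) := IsManifold.of_le (n := ∞) (by simp)
  intro v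
  obtain ⟨e, hv, he⟩ := B.exists_trivialization (B.extProj ι v.1)
  have ho := isOpen_extProj_preimage (B := B) (e := e) ι
  have h1 := (contMDiffOn_extSection ι he).contMDiffOn_tangentMapWithin (m := ∞) (by simp)
    ho.uniqueMDiffOn
  have h2 := (contMDiff_prodForm κ.smooth).comp_contMDiffOn h1
  have h3 : Bundle.TotalSpace.proj ⁻¹' (B.extProj ι ⁻¹' e.baseSet) ∈ 𝓝 v :=
    (ho.preimage (FiberBundle.continuous_proj (EM × EH) (TangentSpace (IM.prod IH)))).mem_nhds hv
  refine (h2.contMDiffAt h3).congr_of_eventuallyEq ?_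
  filter_upwards [h3] with w hw
  refine (κ.extForm_eq he hw w.2).trans ?_
  have h4 := mfderivWithin_of_isOpen (I := IM.prod IH) (I' := IP.prod IH) (f := extSection ι he)
    ho hw
  exact congrArg (fun A : EM × EH →L[ℝ] EP × EH => prodForm κ.form (extSection ι he w.1) (A w.2))
    h4.symm

end Extension
end PrincipalBundle
end

noncomputable section

namespace PrincipalBundle

/-! ### Extension and restriction as inverse bijections. -/

section Extension

variable {EP KP EM KM EG KG EH KH : Type*}
  [NormedAddCommGroup EP] [NormedSpace ℝ EP] [TopologicalSpace KP]
  [NormedAddCommGroup EM] [NormedSpace ℝ EM] [TopologicalSpace KM]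
  [NormedAddCommGroup EG] [NormedSpace ℝ EG] [TopologicalSpace KG]
  [NormedAddCommGroup EH] [NormedSpace ℝ EH] [TopologicalSpace KH]
  {IP : ModelWithCorners ℝ EP KP} {IM : ModelWithCorners ℝ EM KM}
  {IG : ModelWithCorners ℝ EG KG} {IH : ModelWithCorners ℝ EH KH}
  {P M G H : Type*}
  [TopologicalSpace P] [ChartedSpace KP P]
  [TopologicalSpace M] [ChartedSpace KM M]
  [TopologicalSpace G] [ChartedSpace KG G] [Group G]
  [TopologicalSpace H] [ChartedSpace KH H] [Group H]

variable {B : PrincipalBundle IP IM IG P M G} {ι : ContMDiffMonoidMorphism IG IH ∞ G H}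

theorem mdifferentiable_act_left (B : PrincipalBundle IP IM IG P M G) (g : G) :
    MDifferentiable IP IP (fun v : P => B.act v g) :=
  (B.contMDiff_act.comp (contMDiff_id.prodMk contMDiff_const)).mdifferentiable (by simp)

theorem mdifferentiable_act_right (B : PrincipalBundle IP IM IG P M G) (u : P) :
    MDifferentiable IG IP (fun g : G => B.act u g) :=
  (B.contMDiff_act.comp (contMDiff_const.prodMk contMDiff_id)).mdifferentiable (by simp)

theorem PrincipalConnection.form_injective {EQ KQ Q : Type*} [NormedAddCommGroup EQ]
    [NormedSpace ℝ EQ] [TopologicalSpace KQ] {IQ : ModelWithCorners ℝ EQ KQ}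
    [TopologicalSpace Q] [ChartedSpace KQ Q] [IsManifold IQ ∞ Q]
    {C : PrincipalBundle IQ IM IH Q M H} {θ θ' : C.PrincipalConnection}
    (h : θ.form = θ'.form) : θ = θ' := by
  cases θ; cases θ'; congr

theorem GeneralizedCartanConnection.form_injective [IsManifold IP ∞ P]
    {κ κ' : B.GeneralizedCartanConnection ι}
    (h : κ.form = κ'.form) : κ = κ' := by
  cases κ; cases κ'; congr

variable [LieGroup IH ∞ H]

/-- Both summands pick up $\mathrm{Ad}(k^{-1})$: the first by right equivariance of the
Maurer-Cartan form, the second because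
$\mathrm{Ad}((hk)^{-1})=\mathrm{Ad}(k^{-1})\mathrm{Ad}(h^{-1})$. -/
theorem prodForm_mul_right (α : ∀ u : P, TangentSpace IP u →L[ℝ] GroupLieAlgebra IH H) (p : P × H)
    (k : H) (w : TangentSpace (IP.prod IH) p) :
    prodForm α (p.1, p.2 * k)
        (mfderiv (IP.prod IH) (IP.prod IH) (fun p : P × H => (p.1, p.2 * k)) p w) =
      lieAd IH k⁻¹ (prodForm α p w) := by
  have hk : MDifferentiableAt (IP.prod IH) IH (fun p : P × H => p.2 * k) p :=
    (mdifferentiableAt_lie_mul_right k p.2).comp p mdifferentiableAt_snd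
  have h1 := prodForm_mfderiv α (f := fun p : P × H => p.1) mdifferentiableAt_fst hk w
  have h2 := mfderiv_comp_apply (I := IP.prod IH) (I' := IH) (I'' := IH) p
    (mdifferentiableAt_lie_mul_right k p.2) mdifferentiableAt_snd w
  have h3 := maurerCartan_mfderiv_mul_right p.2 k (mfderiv (IP.prod IH) IH Prod.snd p w)
  refine h1.trans ?_
  rw [mul_inv_rev, lieAd_mul]
  refine Eq.trans ?_ (map_add (lieAd IH k⁻¹) _ _).symm
  exact congrArg₂ (· + ·) ((congrArg (maurerCartan IH (p.2 * k)) h2).trans h3) rfl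

variable [IsManifold IM ∞ M]

theorem contMDiff_extMk_left (h : H) :
    ContMDiff IP (IM.prod IH) ∞ (fun u : P => B.extMk ι (u, h)) :=
  (B.contMDiff_extMk ι).comp (contMDiff_id.prodMk contMDiff_const)

theorem mdifferentiable_extMk_left (h : H) :
    MDifferentiable IP (IM.prod IH) (fun u : P => B.extMk ι (u, h)) :=
  (contMDiff_extMk_left h).mdifferentiable (by simp)

theorem mfderiv_extMk_left (u : P) (h : H) (X : TangentSpace IP u) :
    mfderiv IP (IM.prod IH) (fun v : P => B.extMk ι (v, h)) u X =
      mfderiv (IP.prod IH) (IM.prod IH) (B.extMk ι) (u, h) (X, (0 : TangentSpace IH h)) := by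
  have h1 := mfderiv_comp_apply (I := IP) (I' := IP.prod IH) (I'' := IM.prod IH) u
    (f := fun v : P => (v, h)) (B.mdifferentiable_extMk ι (u, h))
    (mdifferentiableAt_id.prodMk mdifferentiableAt_const) X
  rw [mfderiv_prod_left] at h1
  exact h1

/-- The orbit map of $q(u,h)$ is $k\mapsto q(u,hk)$, which factors through $\{u\}\times H$. -/
theorem extend_fundamental (u : P) (h : H) (Y : GroupLieAlgebra IH H) :
    (B.extend ι).fundamental Y (B.extMk ι (u, h)) =
      mfderiv (IP.prod IH) (IM.prod IH) (B.extMk ι) (u, h)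
        ((0 : TangentSpace IP u), mulInvariantVectorField Y h) := by
  have h1 := mfderiv_comp_apply_of_eq (I := IH) (I' := IP.prod IH) (I'' := IM.prod IH) (1 : H)
    (f := fun k : H => (u, h * k)) (y := (u, h)) (B.mdifferentiable_extMk ι (u, h))
    (mdifferentiableAt_const.prodMk (mdifferentiableAt_lie_mul_left _ _)) (by simp) Y
  rw [mfderiv_prodMk mdifferentiableAt_const (mdifferentiableAt_lie_mul_left _ _),
    mfderiv_const] at h1
  exact h1

variable [IsManifold IP ∞ P]

/-- The principal connection on `P[H]` that extends a generalized Cartan connection on `P`. -/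
def GeneralizedCartanConnection.extend [LieGroup IG ∞ G] (κ : B.GeneralizedCartanConnection ι) :
    (B.extend ι).PrincipalConnection where
  form := κ.extForm
  smooth := κ.contMDiff_extForm
  equivariant y k v := by
    obtain ⟨u, h, rfl, hs⟩ := exists_mfderiv_extMk ι y
    obtain ⟨X, Y, hv⟩ := hs v
    have h1 := mfderiv_comp_apply (I := IP.prod IH) (I' := IM.prod IH) (I'' := IM.prod IH) (u, h)
      ((B.extend ι).mdifferentiable_act_left k _) (B.mdifferentiable_extMk ι (u, h))
      (X, mulInvariantVectorField Y h)
    have h2 := mfderiv_comp_apply (I := IP.prod IH) (I' := IP.prod IH) (I'' := IM.prod IH) (u, h)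
      (f := fun p : P × H => (p.1, p.2 * k)) (B.mdifferentiable_extMk ι _)
      (mdifferentiableAt_fst.prodMk
        ((mdifferentiableAt_lie_mul_right k h).comp (u, h) mdifferentiableAt_snd))
      (X, mulInvariantVectorField Y h)
    have h3 := κ.extForm_mfderiv_extMk (u, h * k)
      (mfderiv (IP.prod IH) (IP.prod IH) (fun p : P × H => (p.1, p.2 * k)) (u, h)
        (X, mulInvariantVectorField Y h))
    have h4 := prodForm_mul_right κ.form (u, h) k (X, mulInvariantVectorField Y h)
    have h5 := κ.extForm_mfderiv_extMk (u, h) (X, mulInvariantVectorField Y h)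
    rw [hv] at h1 h5
    rw [h5]
    -- Since $q(u,h)\cdot k=q(u,hk)$, the action can be differentiated upstairs on $P\times H$,
    -- where equivariance is already known.
    refine Eq.trans ?_ (h3.trans h4)
    exact congrArg (κ.extForm (B.extMk ι (u, h * k))) (h1.symm.trans h2)
  reproduces y Y := by
    obtain ⟨⟨u, h⟩, rfl⟩ := B.extMk_surjective ι y
    rw [extend_fundamental, κ.extForm_mfderiv_extMk_apply, map_zero, map_zero, add_zero]

/-- The generalized Cartan connection on `P` that a principal connection on `P[H]` restricts to. -/
def PrincipalConnection.restrict (θ : (B.extend ι).PrincipalConnection) :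
    B.GeneralizedCartanConnection ι where
  form u := (θ.form (B.extMk ι (u, 1))).comp
    (mfderiv IP (IM.prod IH) (fun v : P => B.extMk ι (v, 1)) u)
  smooth := by
    have : IsManifold IP 1 P := IsManifold.of_le (n := ∞) (by simp)
    have : IsManifold (IM.prod IH) 1 (B.Ext ι) := IsManifold.of_le (n := ∞) (by simp)
    exact θ.smooth.comp ((contMDiff_extMk_left 1).contMDiff_tangentMap (m := ∞) (by simp))
  equivariant u g X := by
    have h1 := mfderiv_comp_apply (I := IP) (I' := IP) (I'' := IM.prod IH) u
      (mdifferentiable_extMk_left (B := B) (ι := ι) 1 _) (B.mdifferentiable_act_left g u) X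
    have h2 := mfderiv_comp_apply (I := IP) (I' := IM.prod IH) (I'' := IM.prod IH) u
      ((B.extend ι).mdifferentiable_act_left (ι g) _)
      (mdifferentiable_extMk_left (B := B) (ι := ι) 1 u) X
    -- The map $v\mapsto q(v,e)$ is $G$-equivariant: $q(v\cdot
    -- g,e)=q(v,\iota(g))=q(v,e)\cdot\iota(g)$.
    have h3 : (fun v : P => B.extMk ι (v, 1)) ∘ (fun v : P => B.act v g) =
        (fun y => (B.extend ι).act y (ι g)) ∘ (fun v : P => B.extMk ι (v, 1)) := by
      funext v
      exact (B.extMk_act ι v g 1).trans (by simp [extend])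
    have h4 := form_mfderiv_congr (IN := IP) θ.form (.of_eq h3) X
    have h5 := θ.equivariant (B.extMk ι (u, 1)) (ι g)
      (mfderiv IP (IM.prod IH) (fun v : P => B.extMk ι (v, 1)) u X)
    rw [map_inv]
    refine Eq.trans ?_ (h4.trans (Eq.trans ?_ h5))
    · exact congrArg (θ.form (B.extMk ι (B.act u g, 1))) h1.symm
    · exact congrArg (θ.form ((B.extend ι).act (B.extMk ι (u, 1)) (ι g))) h2
  reproduces u X := by
    have hι : MDifferentiable IG IH ι := ι.contMDiff_toFun.mdifferentiable (by simp)
    have h1 := mfderiv_comp_apply_of_eq (I := IG) (I' := IP) (I'' := IM.prod IH) (1 : G)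
      (mdifferentiable_extMk_left (B := B) (ι := ι) 1 u) (B.mdifferentiable_act_right u 1)
      (B.act_one u) X
    have h2 := mfderiv_comp_apply_of_eq (I := IG) (I' := IH) (I'' := IM.prod IH) (1 : G)
      ((B.extend ι).mdifferentiable_act_right (B.extMk ι (u, 1)) 1) (hι 1) (map_one ι) X
    have h3 : (fun v : P => B.extMk ι (v, 1)) ∘ (fun g : G => B.act u g) =
        (fun k => (B.extend ι).act (B.extMk ι (u, 1)) k) ∘ ι := by
      funext g
      exact (B.extMk_act ι u g 1).trans (by simp [extend])
    have h4 : @Eq (EG →L[ℝ] EM × EH)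
        (mfderiv IG (IM.prod IH) ((fun v : P => B.extMk ι (v, 1)) ∘ (fun g : G => B.act u g)) 1)
        (mfderiv IG (IM.prod IH) ((fun k => (B.extend ι).act (B.extMk ι (u, 1)) k) ∘ ι) 1) :=
      mfderiv_congr h3
    have h5 := θ.reproduces (B.extMk ι (u, 1)) (mfderiv IG IH ι 1 X)
    refine Eq.trans ?_ h5
    exact congrArg (θ.form (B.extMk ι (u, 1)))
      (h1.symm.trans ((congrArg (fun A : EG →L[ℝ] EM × EH => A X) h4).trans h2))

theorem PrincipalConnection.restrict_apply (θ : (B.extend ι).PrincipalConnection) (u : P)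
    (X : TangentSpace IP u) :
    θ.restrict.form u X = θ.form (B.extMk ι (u, 1))
      (mfderiv (IP.prod IH) (IM.prod IH) (B.extMk ι) (u, 1) (X, (0 : TangentSpace IH (1 : H)))) :=
  congrArg (θ.form (B.extMk ι (u, 1))) (mfderiv_extMk_left u 1 X)

/-- The pullback of a principal connection on `P[H]` to `P × H`. -/
theorem PrincipalConnection.form_mfderiv_extMk (θ : (B.extend ι).PrincipalConnection) (u : P)
    (h : H) (X : TangentSpace IP u) (Y : GroupLieAlgebra IH H) :
    θ.form (B.extMk ι (u, h)) (mfderiv (IP.prod IH) (IM.prod IH) (B.extMk ι) (u, h)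
      (X, mulInvariantVectorField Y h)) = Y + lieAd IH h⁻¹ (θ.restrict.form u X) := by
  have h1 := θ.reproduces (B.extMk ι (u, h)) Y
  rw [extend_fundamental] at h1
  have h2 := mfderiv_comp_apply (I := IP) (I' := IM.prod IH) (I'' := IM.prod IH) u
    ((B.extend ι).mdifferentiable_act_left h _)
    (mdifferentiable_extMk_left (B := B) (ι := ι) 1 u) X
  have h3 : (fun v : P => B.extMk ι (v, h)) =
      (fun y => (B.extend ι).act y h) ∘ (fun v : P => B.extMk ι (v, 1)) := by
    funext v
    simp [extend]
  have h4 := form_mfderiv_congr (IN := IP) θ.form (.of_eq h3) X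
  have h5 := θ.equivariant (B.extMk ι (u, 1)) h
    (mfderiv IP (IM.prod IH) (fun v : P => B.extMk ι (v, 1)) u X)
  -- The vector $Tq(X,0)$ at $q(u,h)$ is the right translate by $h$ of the one at $q(u,e)$, so
  -- equivariance of $\theta$ applies.
  have h6 : θ.form (B.extMk ι (u, h)) (mfderiv (IP.prod IH) (IM.prod IH) (B.extMk ι) (u, h)
      (X, (0 : TangentSpace IH h))) = lieAd IH h⁻¹ (θ.restrict.form u X) := by
    rw [← mfderiv_extMk_left]
    refine h4.trans (Eq.trans ?_ h5)
    exact congrArg (θ.form ((B.extend ι).act (B.extMk ι (u, 1)) h)) h2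
  rw [← h6]
  refine Eq.trans ?_ (congrArg (· + _) h1)
  -- Typing the pullback on the model space permits the splitting $(X,Z)=(0,Z)+(X,0)$ into a part
  -- covered by `h1` and a part covered by `h6`.
  let L : EP × EH →L[ℝ] EH := (θ.form (B.extMk ι (u, h))).comp
    (mfderiv (IP.prod IH) (IM.prod IH) (B.extMk ι) (u, h))
  refine Eq.trans ?_ (L.map_add ((0 : EP), (mulInvariantVectorField Y h : EH)) (X, 0))
  exact congrArg L
    (Prod.ext (zero_add (X : EP)).symm (add_zero (mulInvariantVectorField Y h : EH)).symm)

/-- Generalized Cartan connections on `P` correspond to principal connections on `P[H]`. -/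
def connectionEquiv [LieGroup IG ∞ G] (B : PrincipalBundle IP IM IG P M G)
    (ι : ContMDiffMonoidMorphism IG IH ∞ G H) :
    B.GeneralizedCartanConnection ι ≃ (B.extend ι).PrincipalConnection where
  toFun κ := κ.extend
  invFun θ := θ.restrict
  left_inv κ := by
    refine GeneralizedCartanConnection.form_injective ?_
    funext u
    refine ContinuousLinearMap.ext fun X => ?_
    have h1 := κ.extForm_mfderiv_extMk (u, 1) (X, (0 : TangentSpace IH (1 : H)))
    rw [κ.extend.restrict_apply]
    refine h1.trans ?_
    rw [prodForm_apply, map_zero, zero_add, inv_one, lieAd_one]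
  right_inv θ := by
    refine PrincipalConnection.form_injective (extForm_ext ι fun u h X Y => ?_)
    rw [θ.form_mfderiv_extMk]
    exact θ.restrict.extForm_mfderiv_extMk_apply u h X Y

end Extension
end PrincipalBundle
end

theorem lemma3p2 {EP KP EM KM EG KG EH KH : Type*}
    [NormedAddCommGroup EP] [NormedSpace ℝ EP] [FiniteDimensional ℝ EP] [TopologicalSpace KP]
    [NormedAddCommGroup EM] [NormedSpace ℝ EM] [FiniteDimensional ℝ EM] [TopologicalSpace KM]
    [NormedAddCommGroup EG] [NormedSpace ℝ EG] [FiniteDimensional ℝ EG] [TopologicalSpace KG]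
    [NormedAddCommGroup EH] [NormedSpace ℝ EH] [FiniteDimensional ℝ EH] [TopologicalSpace KH]
    (IP : ModelWithCorners ℝ EP KP) [IP.Boundaryless]
    (IM : ModelWithCorners ℝ EM KM) [IM.Boundaryless]
    (IG : ModelWithCorners ℝ EG KG) [IG.Boundaryless]
    (IH : ModelWithCorners ℝ EH KH) [IH.Boundaryless]
    {P M G H : Type*}
    [TopologicalSpace P] [ChartedSpace KP P] [IsManifold IP ∞ P]
    [TopologicalSpace M] [ChartedSpace KM M] [IsManifold IM ∞ M]
    [TopologicalSpace G] [ChartedSpace KG G] [Group G] [LieGroup IG ∞ G]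
    [TopologicalSpace H] [ChartedSpace KH H] [Group H] [LieGroup IH ∞ H]
    (B : PrincipalBundle IP IM IG P M G)
    (ι : ContMDiffMonoidMorphism IG IH ∞ G H) (hι : IsLieSubgroup ι) :
    ∃ F : B.GeneralizedCartanConnection ι ≃ (B.extend ι).PrincipalConnection,
      -- the explicit formula for the correspondence
      (∀ (κ : B.GeneralizedCartanConnection ι) (u : P) (h : H) (X : TangentSpace IP u)
          (Y : GroupLieAlgebra IH H),
        (F κ).form (B.extMk ι (u, h))
            (mfderiv (IP.prod IH) (IM.prod IH) (B.extMk ι) (u, h)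
              (X, mulInvariantVectorField Y h))
          = Y + lieAd IH h⁻¹ (κ.form u X)) ∧
      -- the explicit formula for its inverse
      (∀ (θ : (B.extend ι).PrincipalConnection) (u : P) (X : TangentSpace IP u),
        (F.symm θ).form u X
          = θ.form (B.extMk ι (u, 1))
              (mfderiv (IP.prod IH) (IM.prod IH) (B.extMk ι) (u, 1)
                (X, (0 : TangentSpace IH (1 : H))))) ∧
      -- the first formula determines the form `F κ` uniquely
      (∀ (κ : B.GeneralizedCartanConnection ι)
          (θ : ∀ y : B.Ext ι, TangentSpace (IM.prod IH) y →L[ℝ] GroupLieAlgebra IH H),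
        (∀ (u : P) (h : H) (X : TangentSpace IP u) (Y : GroupLieAlgebra IH H),
          θ (B.extMk ι (u, h))
              (mfderiv (IP.prod IH) (IM.prod IH) (B.extMk ι) (u, h)
                (X, mulInvariantVectorField Y h))
            = Y + lieAd IH h⁻¹ (κ.form u X)) →
        θ = (F κ).form) := by
  refine ⟨B.connectionEquiv ι, fun κ u h X Y => κ.extForm_mfderiv_extMk_apply u h X Y,
    fun θ u X => θ.restrict_apply u X, fun κ θ hθ => PrincipalBundle.extForm_ext ι ?_⟩
  intro u h X Y
  exact (hθ u h X Y).trans (κ.extForm_mfderiv_extMk_apply u h X Y).symm
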